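/- For a finite group $G$ and a positive integer $k$, let $d_k(G)$ be the smallest positive integer $m$ such that every sequence of $m$ elements of $G$ (repetitions allowed) has $k$ disjoint product-one subsequences, that is, there are $k$ pairwise disjoint nonempty sets of indices such that, for each of them, the terms with these indices have product $1$ in some order. Let $p$ be a prime and let $k, n$ be positive integers. (a) If $n \ge 2$, then the dihedral group $\mathbf{D}_{2n} = \langle x, y \mid x^n = y^2 = 1,\ x^{-1}y = yx\rangle$ of order $2n$ satisfies $d_k(\mathbf{D}_{2n}) = nk+1$. (b) If $n \ge 2$, then the dicyclic group $\mathbf{Q}_{4n} = \langle x, y \mid x^n = y^2,\ x^{2n} = 1,\ x^{-1}y = yx\rangle$ of order $4n$ satisfies $d_k(\mathbf{Q}_{4n}) = 2nk+1$. (c) If $g$ is an integer that has multiplicative order exactly $p$ modulo $n$, then the metacyclic group $\mathbb{Z}_p \ltimes_g \mathbb{Z}_n = \langle x, y \mid x^n = y^p = 1,\ x^g y = yx\rangle$ satisfies $d_k(\mathbb{Z}_p \ltimes_g \mathbb{Z}_n) = nk+p-1$. -/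

import Mathlib

/-- `productSet S I` is the set `Π(T)` of all products, taken in every possible order, of the terms
of the subsequence `T` of `S = (S 0, …, S (m - 1))` with index set `I`. A list `l` of indices
without repetition and with underlying set `I` is an ordering of the terms of `T`. -/
def productSet {G : Type*} [Group G] {m : ℕ} (S : Fin m → G) (I : Finset (Fin m)) : Set G :=
  {h | ∃ l : List (Fin m), l.Nodup ∧ l.toFinset = I ∧ (l.map S).prod = h}

/-- The index set `I` gives a product-one subsequence of `S`: it is nonempty, and the terms of `S`
with index in `I` have product `1` in some order. -/
def IsProductOneSubseq {G : Type*} [Group G] {m : ℕ} (S : Fin m → G) (I : Finset (Fin m)) : Prop :=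
  I.Nonempty ∧ (1 : G) ∈ productSet S I

/-- The sequence `S` has `k` product-one subsequences whose index sets are pairwise disjoint. -/
def HasDisjointProductOne {G : Type*} [Group G] (k : ℕ) {m : ℕ} (S : Fin m → G) : Prop :=
  ∃ I : Fin k → Finset (Fin m),
    (∀ j, IsProductOneSubseq S (I j)) ∧ ∀ i j, i ≠ j → Disjoint (I i) (I j)

/-- The `k`-th Davenport constant `d_k(G)`: the smallest positive integer `m` such that every
sequence of length `m` in `G` has `k` disjoint product-one subsequences. (The infimum in `ℕ` is
attained unless the set is empty, in which case its value is `0`; so an equation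
`kthDavenport k G = c` with `c > 0` says that `c` is the least element of the set.) -/
noncomputable def kthDavenport (k : ℕ) (G : Type*) [Group G] : ℕ :=
  sInf {m : ℕ | 0 < m ∧ ∀ S : Fin m → G, HasDisjointProductOne k S}

/-- For a unit `g` of order `a` modulo `b`, the action of `ℤ/a` on `ℤ/b` in which the class of `j`
acts as multiplication by `g ^ j`. Both groups are written multiplicatively. -/
def metacyclicAction (a b : ℕ) (g : (ZMod b)ˣ) (hg : orderOf g = a) :
    Multiplicative (ZMod a) →* MulAut (Multiplicative (ZMod b)) where
  toFun j := AddEquiv.toMultiplicative (DistribMulAction.toAddEquiv (ZMod b) (g ^ j.toAdd.val))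
  map_one' := by
    ext x
    simp
  map_mul' i j := by
    have ha : NeZero a := by
      constructor
      rw [← hg]
      rcases b with _ | b
      · have : Finite (ZMod 0)ˣ := inferInstanceAs (Finite ℤˣ)
        exact (orderOf_pos g).ne'
      · exact (orderOf_pos g).ne'
    ext x
    have h : g ^ (i.toAdd + j.toAdd).val = g ^ i.toAdd.val * g ^ j.toAdd.val := by
      have hga : g ^ a = 1 := by
        rw [← hg]
        exact pow_orderOf_eq_one g
      rw [ZMod.val_add, ← pow_add, ← pow_eq_pow_mod _ hga]
    simp [h, mul_smul]

/-- The metacyclic group `ℤ_a ⋉_g ℤ_b = ⟨x, y | x ^ b = y ^ a = 1, x ^ g * y = y * x⟩`, where `g` has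
order `a` modulo `b`. Here `x` is the generator of the normal factor `ℤ/b`, `y` is the generator of
`ℤ/a`, and `y * x * y⁻¹ = x ^ g`. -/
abbrev MetacyclicGroup (a b : ℕ) (g : (ZMod b)ˣ) (hg : orderOf g = a) : Type :=
  Multiplicative (ZMod b) ⋊[metacyclicAction a b g hg] Multiplicative (ZMod a)

/-! Lower bound (`not_forall_hasDisjointProductOne`): take `p - 1` copies of `y` followed by copies
of `x`. Mapping onto `ℤ/p` shows that no product-one subsequence uses a `y`, so each one consists of
a positive multiple of `n` copies of `x`. Cases (a) and (b) use the same argument with `p = 2`, and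
with `orderOf x = 2 * n` in (b).

Upper bound: `DisjointBound G a b` passes up along surjections (`DisjointBound.of_surjective`). If
the kernel has order `h`, then `h * k` disjoint subsequences with product in the kernel regroup into
`k` with product one, by the pigeonhole bound `disjointBound_natCard` for the kernel. Thus `a` is
multiplied by `h` and `b` is unchanged, and only small quotients remain. If `p ∣ n`, then `g ≡ 1`
modulo `p` and the quotient is `(ℤ/p)²`. Otherwise `g` keeps order `p` modulo some prime `q ∣ n` and
the quotient is `ℤ/p ⋉ ℤ/q`. Dihedral groups map onto `(ℤ/2)²` or onto such a group with `p = 2`;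
dicyclic groups map onto dihedral ones.

For a small quotient, `disjointBound_of_short` asks for two facts: `a + b` terms contain a
product-one subsequence, and `2 * a + b` terms contain one of length at most `a`. For `(ℤ/p)²` both
come from Chevalley–Warning. For `ℤ/p ⋉ ℤ/q` the sequence is cut into blocks, which are minimal
pieces with trivial image in `ℤ/p`. A block multiplies to a translation. Rotating it, or inserting
it at different places of another block, scales that translation by different powers of `g`. By
Cauchy–Davenport the reachable translations fill `ℤ/q`, so `0` is reached. The short version needs
blocks of length at most `(p + 1) / 2` and a separate treatment of terms that mostly share one
degree. -/

/-- `HasProductListsIn K k S`: the multiset `S` contains `k` disjoint nonempty subsequences,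
given as lists, whose ordered products lie in the subgroup `K`. -/
def HasProductListsIn {G : Type*} [Group G] (K : Subgroup G) (k : ℕ) (S : Multiset G) : Prop :=
  ∃ Ls : List (List G), Ls.length = k ∧ (∀ l ∈ Ls, l ≠ [] ∧ l.prod ∈ K) ∧
    (Ls.flatten : Multiset G) ≤ S

/-- Every sequence of length `a * k + b` has `k` disjoint product-one subsequences. -/
def DisjointBound (G : Type*) [Group G] (a b : ℕ) : Prop :=
  ∀ (k : ℕ) (S : Multiset G), 0 < k → a * k + b ≤ S.card → HasProductListsIn (⊥ : Subgroup G) k S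

/-! ### Lifting sublists through maps. -/

section Lifting

theorem exists_list_lift {α β : Type*} (f : α → β) (l : List β) :
    ∀ T : Multiset α, (l : Multiset β) ≤ T.map f →
      ∃ l' : List α, l'.map f = l ∧ (l' : Multiset α) ≤ T := by
  classical
  induction l with
  | nil => exact fun T _ => ⟨[], rfl, by simp⟩
  | cons b l ih =>
    intro T hT
    have hb : b ∈ T.map f := Multiset.mem_of_le hT (by simp)
    obtain ⟨x, hx, rfl⟩ := Multiset.mem_map.1 hb
    obtain ⟨T', rfl⟩ := Multiset.exists_cons_of_mem hx
    rw [Multiset.map_cons, ← Multiset.cons_coe, Multiset.cons_le_cons_iff] at hT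
    obtain ⟨l', rfl, h'⟩ := ih T' hT
    refine ⟨x :: l', rfl, ?_⟩
    rw [← Multiset.cons_coe]
    exact Multiset.cons_le_cons _ h'

theorem exists_flatten_of_map_eq {α β : Type*} (f : α → β) (Ls : List (List β)) :
    ∀ l : List α, l.map f = Ls.flatten →
      ∃ Ls' : List (List α), Ls'.map (List.map f) = Ls ∧ Ls'.flatten = l := by
  induction Ls with
  | nil => exact fun l hl => ⟨[], rfl, by simpa using hl.symm⟩
  | cons b Ls ih =>
    intro l hl
    rw [List.flatten_cons, List.map_eq_append_iff] at hl
    obtain ⟨l₁, l₂, rfl, rfl, h₂⟩ := hl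
    obtain ⟨Ls', rfl, rfl⟩ := ih l₂ h₂
    exact ⟨l₁ :: Ls', rfl, rfl⟩

theorem exists_lists_lift {α β : Type*} (f : α → β) (Ls : List (List β)) (T : Multiset α)
    (h : (Ls.flatten : Multiset β) ≤ T.map f) :
    ∃ Ls' : List (List α), Ls'.map (List.map f) = Ls ∧ (Ls'.flatten : Multiset α) ≤ T := by
  obtain ⟨l, hl, hT⟩ := exists_list_lift f _ T h
  obtain ⟨Ls', h₁, rfl⟩ := exists_flatten_of_map_eq f Ls l hl
  exact ⟨Ls', h₁, hT⟩

theorem coe_flatten_le_of_coe_le {α : Type*} {A B : List (List α)}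
    (h : (A : Multiset (List α)) ≤ B) : (A.flatten : Multiset α) ≤ B.flatten := by
  obtain ⟨C, hC, hs⟩ := Multiset.coe_le.1 h
  exact Multiset.coe_le.2 ⟨C.flatten, hC.flatten, hs.flatten⟩

theorem flatten_ne_nil_of_forall {α : Type*} {L : List (List α)} (h : L ≠ [])
    (hL : ∀ l ∈ L, l ≠ []) : L.flatten ≠ [] := by
  cases L with
  | nil => exact absurd rfl h
  | cons a L =>
    intro h0
    simp only [List.flatten_cons, List.append_eq_nil_iff] at h0
    exact hL a (by simp) h0.1

end Lifting

/-! ### Reductions: from lists to index sets, induction on `k`, quotients. -/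

theorem HasProductListsIn.hasDisjointProductOne {G : Type*} [Group G] {k m : ℕ} {S : Fin m → G}
    (h : HasProductListsIn (⊥ : Subgroup G) k (Finset.univ.val.map S)) :
    HasDisjointProductOne k S := by
  obtain ⟨Ls, hk, hL, hS⟩ := h
  obtain ⟨Ls', rfl, hle⟩ := exists_lists_lift S Ls _ hS
  have hnd : Ls'.flatten.Nodup := Multiset.coe_nodup.1 (Multiset.nodup_of_le hle Finset.univ.nodup)
  rw [List.nodup_flatten] at hnd
  rw [List.length_map] at hk
  subst hk
  refine ⟨fun j => (Ls'[j]).toFinset, fun j => ?_, fun i j hij => ?_⟩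
  · have hm : Ls'[j] ∈ Ls' := List.getElem_mem _
    obtain ⟨h₁, h₂⟩ := hL _ (List.mem_map_of_mem hm)
    refine ⟨?_, Ls'[j], hnd.1 _ hm, rfl, by simpa using h₂⟩
    rw [List.toFinset_nonempty_iff]
    intro h0
    exact h₁ (by rw [h0]; rfl)
  · have := List.pairwise_iff_getElem.1 hnd.2
    rw [Finset.disjoint_left]
    intro a ha hb
    simp only [List.mem_toFinset] at ha hb
    rcases lt_or_gt_of_ne (Fin.val_ne_of_ne hij) with h | h
    · exact this _ _ i.2 j.2 h ha hb
    · exact this _ _ j.2 i.2 h hb ha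

/-- Removing a short product-one subsequence costs at most `a` terms, which is the decrease of the
bound when `k` drops by one. The last subsequence may have any length, so the weaker hypothesis on
`a + b` terms suffices for `k = 1`. -/
theorem disjointBound_of_short {G : Type*} [Group G] {a b : ℕ}
    (h₁ : ∀ S : Multiset G, a + b ≤ S.card → ∃ l : List G, l ≠ [] ∧ l.prod = 1 ∧ (l : Multiset G) ≤ S)
    (h₂ : ∀ S : Multiset G, 2 * a + b ≤ S.card →
      ∃ l : List G, l ≠ [] ∧ l.prod = 1 ∧ l.length ≤ a ∧ (l : Multiset G) ≤ S) :
    DisjointBound G a b := by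
  classical
  intro k S hk
  induction k, hk using Nat.le_induction generalizing S with
  | base =>
    intro hS
    obtain ⟨l, hl, hp, hle⟩ := h₁ S (by simpa using hS)
    exact ⟨[l], rfl, by simpa using ⟨hl, hp⟩, by simpa using hle⟩
  | succ k hk ih =>
    intro hS
    have hak : a * 1 ≤ a * k := Nat.mul_le_mul_left _ hk
    rw [mul_add] at hS
    obtain ⟨l, hl, hp, hlen, hle⟩ := h₂ S (by omega)
    have hc : (S - (l : Multiset G)).card = S.card - l.length := by
      rw [Multiset.card_sub hle, Multiset.coe_card]
    obtain ⟨Ls, hLk, hL, hLS⟩ := ih (S - l) (by omega)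
    refine ⟨l :: Ls, by simp [hLk], ?_, ?_⟩
    · rintro l' (_ | ⟨_, h'⟩)
      · exact ⟨hl, by simpa using hp⟩
      · exact hL _ h'
    · rw [List.flatten_cons, ← Multiset.coe_add]
      calc (l : Multiset G) + Ls.flatten ≤ l + (S - l) := by gcongr
        _ = S := add_tsub_cancel_of_le hle

/-- Two of the `Nat.card G + 1` initial products agree by pigeonhole, and the segment between them
has product one. -/
theorem exists_infix_prod_eq_one {G : Type*} [Group G] [Finite G] (l : List G)
    (hl : Nat.card G ≤ l.length) :
    ∃ l' : List G, l' ≠ [] ∧ l'.prod = 1 ∧ l'.length ≤ Nat.card G ∧ l'.Sublist l := by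
  classical
  have := Fintype.ofFinite G
  obtain ⟨i, j, hij, he⟩ := Fintype.exists_ne_map_eq_of_card_lt
    (fun i : Fin (Nat.card G + 1) => (l.take i).prod) (by simp)
  wlog h : i < j generalizing i j
  · exact this j i hij.symm he.symm (lt_of_le_of_ne (not_lt.1 h) hij.symm)
  refine ⟨(l.take j).drop i, ?_, ?_, ?_, (List.drop_sublist _ _).trans (List.take_sublist _ _)⟩
  · rw [← List.length_pos_iff]
    simp only [List.length_drop, List.length_take]
    have := j.2
    have : (i : ℕ) < j := h
    omega
  · have h1 := List.prod_take_mul_prod_drop (l.take j) i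
    rw [List.take_take, min_eq_left (show (i : ℕ) ≤ j from le_of_lt h)] at h1
    rw [he] at h1
    simpa using h1
  · simp only [List.length_drop, List.length_take]
    have := j.2
    omega

theorem disjointBound_natCard (G : Type*) [Group G] [Finite G] :
    DisjointBound G (Nat.card G) 0 := by
  have key : ∀ S : Multiset G, Nat.card G ≤ S.card →
      ∃ l : List G, l ≠ [] ∧ l.prod = 1 ∧ l.length ≤ Nat.card G ∧ (l : Multiset G) ≤ S := by
    intro S hS
    induction S using Quotient.inductionOn with | _ l
    obtain ⟨l', h₁, h₂, h₃, h₄⟩ := exists_infix_prod_eq_one l (by simpa using hS)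
    exact ⟨l', h₁, h₂, h₃, Multiset.coe_le.2 h₄.subperm⟩
  refine disjointBound_of_short (fun S hS => ?_) (fun S hS => key S (by omega))
  obtain ⟨l, h₁, h₂, -, h₃⟩ := key S (by omega)
  exact ⟨l, h₁, h₂, h₃⟩

/-- The products of the given lists form a sequence in `K` of length `Nat.card K * k`. The
pigeonhole bound for `K` selects `k` disjoint groups of them with product one, and concatenating the
lists in each group proves the claim. -/
theorem HasProductListsIn.of_mul_card {G : Type*} [Group G] {K : Subgroup G} [Finite K] {k : ℕ}
    (hk : 0 < k) {S : Multiset G} (h : HasProductListsIn K (Nat.card K * k) S) :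
    HasProductListsIn (⊥ : Subgroup G) k S := by
  obtain ⟨Ls, hlen, hL, hS⟩ := h
  have hmem : ∀ x ∈ Ls.map List.prod, x ∈ K := by
    intro x hx
    obtain ⟨l, hl, rfl⟩ := List.mem_map.1 hx
    exact (hL l hl).2
  lift Ls.map List.prod to List K using hmem with Ms hMs
  obtain ⟨Is, hIk, hI, hIM⟩ := disjointBound_natCard K k (Ms : Multiset K) hk (by
    have := congrArg List.length hMs
    simp only [List.length_map] at this
    simp [this, hlen])
  have h1 : ((Is.map (List.map Subtype.val)).flatten : Multiset G) ≤
      (Ls : Multiset (List G)).map List.prod := by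
    rw [Multiset.map_coe, ← hMs, ← List.map_flatten, ← Multiset.map_coe, ← Multiset.map_coe]
    exact Multiset.map_le_map hIM
  obtain ⟨Js, hJ, hJL⟩ := exists_lists_lift _ _ _ h1
  have hJmem : ∀ J ∈ Js, ∀ l ∈ J, l ∈ Ls := by
    intro J hJ' l hl
    have : l ∈ (Js.flatten : Multiset (List G)) := by
      simpa using ⟨J, hJ', hl⟩
    simpa using Multiset.mem_of_le hJL this
  refine ⟨Js.map List.flatten, ?_, ?_, ?_⟩
  · have := congrArg List.length hJ
    simp only [List.length_map] at this
    simp [this, hIk]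
  · intro l hl
    obtain ⟨J, hJ', rfl⟩ := List.mem_map.1 hl
    have : J.map List.prod ∈ Is.map (List.map Subtype.val) := by
      rw [← hJ]
      exact List.mem_map_of_mem hJ'
    obtain ⟨I, hI', hIJ⟩ := List.mem_map.1 this
    obtain ⟨hI0, hI1⟩ := hI I hI'
    refine ⟨flatten_ne_nil_of_forall ?_ fun l hl => (hL l (hJmem J hJ' l hl)).1, ?_⟩
    · rintro rfl
      exact hI0 (List.map_eq_nil_iff.1 hIJ)
    · rw [Subgroup.mem_bot] at hI1 ⊢
      rw [List.prod_flatten, ← hIJ]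
      have := congrArg (Subtype.val : K → G) hI1
      simpa [SubmonoidClass.coe_list_prod] using this
  · have h2 := coe_flatten_le_of_coe_le hJL
    rw [List.flatten_flatten] at h2
    exact h2.trans hS

theorem DisjointBound.of_surjective {G Q : Type*} [Group G] [Finite G] [Group Q] (φ : G →* Q)
    (hφ : Function.Surjective φ) {a b h : ℕ} (hh : 0 < h) (hcard : Nat.card G = Nat.card Q * h)
    (hQ : DisjointBound Q a b) : DisjointBound G (a * h) b := by
  intro k S hk hS
  have : Finite Q := Finite.of_surjective φ hφ
  have hker : Nat.card φ.ker = h := by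
    have h1 := Subgroup.card_eq_card_quotient_mul_card_subgroup φ.ker
    rw [Nat.card_congr (QuotientGroup.quotientKerEquivOfSurjective φ hφ).toEquiv, hcard] at h1
    exact (Nat.eq_of_mul_eq_mul_left Nat.card_pos h1).symm
  apply HasProductListsIn.of_mul_card (K := φ.ker) hk
  obtain ⟨Ls, hk', hL, hLS⟩ := hQ (h * k) (S.map φ) (Nat.mul_pos hh hk) (by
    rw [Multiset.card_map, ← mul_assoc]
    exact hS)
  obtain ⟨Ls', rfl, hle⟩ := exists_lists_lift φ Ls S hLS
  refine ⟨Ls', by rw [hker]; simpa using hk', fun l hl => ?_, hle⟩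
  obtain ⟨h1, h2⟩ := hL _ (List.mem_map_of_mem hl)
  refine ⟨fun h0 => h1 (by simp [h0]), ?_⟩
  rw [MonoidHom.mem_ker, map_list_prod]
  simpa using h2

/-! ### Splitting a multiset into sets. -/

section Partition

theorem Multiset.exists_le_card_eq_of_le {α : Type*} {S : Multiset α} {n : ℕ} (h : n ≤ S.card) :
    ∃ T ≤ S, T.card = n := by
  induction S using Quotient.inductionOn with | _ l
  exact ⟨(l.take n : List α), Multiset.coe_le.2 (List.take_sublist n l).subperm, by simpa using h⟩

/-- A multiset with all multiplicities at most `m` and at least `m` elements is a disjoint union of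
`m` nonempty sets. -/
theorem Multiset.exists_partition_finsets {α : Type*} [DecidableEq α] (m : ℕ) :
    ∀ W : Multiset α, m ≤ W.card → (∀ a, W.count a ≤ m) →
      ∃ As : List (Finset α), As.length = m ∧ (∀ A ∈ As, A.Nonempty) ∧
        (As.map Finset.val).sum = W := by
  induction m with
  | zero =>
    intro W _ hW
    have : W = 0 := Multiset.ext.2 fun a => by simpa using hW a
    exact ⟨[], rfl, by simp, by simp [this]⟩
  | succ m ih =>
    intro W hm hW
    let B : Finset α := W.toFinset.filter fun a => W.count a = m + 1
    have hB : B ⊆ W.toFinset := Finset.filter_subset _ _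
    have hBW : (m + 1) * B.card ≤ W.card := by
      rw [← Multiset.toFinset_sum_count_eq W, mul_comm]
      calc B.card * (m + 1) = ∑ a ∈ B, W.count a := by
            rw [Finset.sum_congr rfl (fun a ha => (Finset.mem_filter.1 ha).2)]
            rw [Finset.sum_const, smul_eq_mul]
        _ ≤ _ := Finset.sum_le_sum_of_subset hB
    -- The first set must contain every element of full multiplicity `m + 1` and leave at least `m`
    -- elements. The whole support works unless it is too large; then a set of `W.card - m` elements
    -- between `B` and the support does.
    have hA : ∃ A, B ⊆ A ∧ A ⊆ W.toFinset ∧ A.Nonempty ∧ A.card + m ≤ W.card := by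
      by_cases h : W.toFinset.card + m ≤ W.card
      · refine ⟨W.toFinset, hB, subset_rfl, ?_, h⟩
        rw [Multiset.toFinset_nonempty, ← Multiset.card_pos]
        omega
      · have hBc : B.card ≤ W.card - m := by
          rcases Nat.eq_zero_or_pos B.card with h0 | h0
          · omega
          · have : m * 1 ≤ m * B.card := Nat.mul_le_mul_left _ h0
            rw [add_mul] at hBW
            omega
        obtain ⟨A, h₁, h₂, h₃⟩ := Finset.exists_subsuperset_card_eq hB hBc (by omega)
        exact ⟨A, h₁, h₂, Finset.card_pos.1 (by omega), by omega⟩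
    obtain ⟨A, hBA, hAW, hA0, hAc⟩ := hA
    have hle : A.val ≤ W := (Finset.val_le_iff_val_subset.2 fun a ha =>
      Multiset.mem_toFinset.1 (hAW ha))
    obtain ⟨As, h₁, h₂, h₃⟩ := ih (W - A.val) (by
      rw [Multiset.card_sub hle, Finset.card_val]
      omega) (by
      intro a
      rw [Multiset.count_sub]
      by_cases ha : a ∈ A
      · have : 1 ≤ A.val.count a := Multiset.one_le_count_iff_mem.2 ha
        have := hW a
        omega
      · have h1 := hW a
        by_cases h2 : W.count a = m + 1
        · refine absurd (hBA (Finset.mem_filter.2 ⟨?_, h2⟩)) ha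
          rw [Multiset.mem_toFinset, ← Multiset.one_le_count_iff_mem]
          omega
        · omega)
    refine ⟨A :: As, by simp [h₁], ?_, ?_⟩
    · rintro C (_ | ⟨_, hC⟩)
      · exact hA0
      · exact h₂ C hC
    · rw [List.map_cons, List.sum_cons, h₃, add_tsub_cancel_of_le hle]

end Partition

/-! ### Iterated Cauchy–Davenport. -/

section CauchyDavenport

open scoped Pointwise

theorem ZMod.min_le_card_sum {q : ℕ} (hq : q.Prime) (D : Finset (ZMod q)) (hD : D.Nonempty) :
    ∀ As : List (Finset (ZMod q)), (∀ A ∈ As, A.Nonempty) →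
      (D + As.sum).Nonempty ∧
      min q (D.card + (As.map fun A => A.card - 1).sum) ≤ (D + As.sum).card := by
  intro As
  induction As generalizing D with
  | nil => simp [hD]
  | cons A As ih =>
    intro hA
    have hA' : A.Nonempty := hA A (by simp)
    obtain ⟨h₁, h₂⟩ := ih (D + A) (hD.add hA') fun B hB => hA B (by simp [hB])
    have h₃ := ZMod.cauchy_davenport hq hD hA'
    have := hA'.card_pos
    rw [List.sum_cons, ← add_assoc, List.map_cons, List.sum_cons]
    refine ⟨h₁, le_trans ?_ h₂⟩
    omega

theorem ZMod.sum_eq_univ {q : ℕ} [NeZero q] (hq : q.Prime) {D : Finset (ZMod q)} (hD : D.Nonempty)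
    {As : List (Finset (ZMod q))} (hA : ∀ A ∈ As, A.Nonempty)
    (h : q ≤ D.card + (As.map fun A => A.card - 1).sum) : D + As.sum = Finset.univ := by
  have := (ZMod.min_le_card_sum hq D hD As hA).2
  rw [min_eq_left h] at this
  apply Finset.eq_univ_of_card
  rw [ZMod.card]
  refine le_antisymm ?_ this
  simpa using Finset.card_le_univ (D + As.sum)

end CauchyDavenport

/-! ### Zero-sum subsequences in `(ℤ/p)^d` and the group `(ℤ/p)²`. -/

section Olson

open MvPolynomial in
/-- The Davenport constant of `(ℤ/p)^d` is at most `d * (p - 1) + 1`. -/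
theorem ZMod.exists_zero_sum_of_card {ι : Type*} [Fintype ι] {p d : ℕ} [Fact p.Prime]
    (f : ι → Fin d → ZMod p) (h : d * (p - 1) < Fintype.card ι) :
    ∃ I : Finset ι, I.Nonempty ∧ ∑ i ∈ I, f i = 0 := by
  classical
  -- Since `x ^ (p - 1)` is the indicator of `x ≠ 0`, a common zero of the `F j` is a point whose
  -- support is a zero-sum index set. Chevalley–Warning yields a zero other than the origin.
  let F : Fin d → MvPolynomial ι (ZMod p) := fun j => ∑ i, C (f i j) * X i ^ (p - 1)
  have hdeg : ∑ j, (F j).totalDegree < Fintype.card ι := by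
    refine lt_of_le_of_lt (Finset.sum_le_card_nsmul _ _ (p - 1) fun j _ => ?_) (by simpa using h)
    refine totalDegree_finsetSum_le fun i _ => ?_
    refine (totalDegree_mul _ _).trans ?_
    rw [totalDegree_C, zero_add, totalDegree_X_pow]
  have hdvd := char_dvd_card_solutions_of_fintype_sum_lt p hdeg
  have hp := (Fact.out : p.Prime)
  have heval : ∀ (x : ι → ZMod p) j, eval x (F j) = ∑ i with x i ≠ 0, f i j := by
    intro x j
    rw [Finset.sum_filter]
    simp only [F, map_sum, map_mul, eval_C, map_pow, eval_X]
    refine Finset.sum_congr rfl fun i _ => ?_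
    by_cases hx : x i = 0
    · simp [hx, Nat.sub_ne_zero_of_lt hp.one_lt]
    · simp [hx, ZMod.pow_card_sub_one_eq_one hx]
  have h0 : ∀ j, eval (0 : ι → ZMod p) (F j) = 0 := fun j => by rw [heval]; simp
  have hpos : 0 < Fintype.card {x : ι → ZMod p // ∀ j, eval x (F j) = 0} :=
    Fintype.card_pos_iff.2 ⟨⟨0, h0⟩⟩
  have h1 : 1 < Fintype.card {x : ι → ZMod p // ∀ j, eval x (F j) = 0} :=
    lt_of_lt_of_le hp.one_lt (Nat.le_of_dvd hpos (by convert hdvd))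
  obtain ⟨⟨x, hx⟩, hne⟩ := Fintype.exists_ne_of_one_lt_card h1 ⟨0, h0⟩
  refine ⟨Finset.univ.filter fun i => x i ≠ 0, ?_, ?_⟩
  · by_contra hn
    rw [Finset.not_nonempty_iff_eq_empty, Finset.filter_eq_empty_iff] at hn
    exact hne (Subtype.ext (funext fun i => by simpa using hn (Finset.mem_univ i)))
  · funext j
    rw [Finset.sum_apply, ← heval]
    exact hx j

/-- Among `3 * p - 2` elements of `(ℤ/p)²` there is a zero-sum subsequence of length at most `p`. -/
theorem ZMod.exists_short_zero_sum {ι : Type*} [Fintype ι] {p : ℕ} [Fact p.Prime]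
    (f : ι → Fin 2 → ZMod p) (h : Fintype.card ι = 3 * (p - 1) + 1) :
    ∃ I : Finset ι, I.Nonempty ∧ I.card ≤ p ∧ ∑ i ∈ I, f i = 0 := by
  classical
  have hp := (Fact.out : p.Prime)
  -- The constant third coordinate forces `p ∣ I.card`, so `I.card` is `p` or `2 * p`.
  obtain ⟨I, hI0, hI⟩ := ZMod.exists_zero_sum_of_card (d := 3) (p := p)
    (fun i => ![f i 0, f i 1, 1]) (by omega)
  have hf : ∑ i ∈ I, f i = 0 := by
    funext j
    rw [Finset.sum_apply]
    fin_cases j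
    · simpa using congrFun hI 0
    · simpa using congrFun hI 1
  have hc : p ∣ I.card := by
    have := congrFun hI 2
    simp only [Finset.sum_apply, Matrix.cons_val, Finset.sum_const, nsmul_eq_mul, mul_one,
      Pi.zero_apply] at this
    exact (ZMod.natCast_eq_zero_iff _ _).1 this
  have hIc : I.card ≤ 3 * (p - 1) + 1 := h ▸ Finset.card_le_univ I
  obtain ⟨t, ht⟩ := hc
  by_cases ht1 : t ≤ 1
  · exact ⟨I, hI0, by rw [ht]; nlinarith, hf⟩
  have ht2 : t = 2 := by
    by_contra hne
    have : p * 3 ≤ p * t := Nat.mul_le_mul_left _ (by omega)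
    have := hp.two_le
    omega
  subst ht2
  -- With `2 * p` indices, drop one: the remaining `2 * (p - 1) + 1` contain a zero-sum set `J'`.
  -- Either `J'` or its complement in `I` has at most `p` elements, and the complement is nonempty
  -- because it contains `x`.
  obtain ⟨x, hx⟩ := hI0
  obtain ⟨J, hJ0, hJ⟩ := ZMod.exists_zero_sum_of_card (d := 2) (p := p)
    (fun i : (I.erase x : Finset ι) => f i) (by
      have := hp.two_le
      rw [Fintype.card_coe, Finset.card_erase_of_mem hx]
      omega)
  let J' : Finset ι := J.map (Function.Embedding.subtype _)
  have hJ' : ∑ i ∈ J', f i = 0 := by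
    rw [Finset.sum_map]
    exact hJ
  have hJI : J' ⊆ I.erase x := by
    intro i hi
    obtain ⟨y, -, rfl⟩ := Finset.mem_map.1 hi
    exact y.2
  have hJI' : J' ⊆ I := hJI.trans (Finset.erase_subset _ _)
  by_cases hJc : J'.card ≤ p
  · exact ⟨J', hJ0.map, hJc, hJ'⟩
  · refine ⟨I \ J', ⟨x, Finset.mem_sdiff.2 ⟨hx, fun h' => by simpa using hJI h'⟩⟩, ?_, ?_⟩
    · rw [Finset.card_sdiff_of_subset hJI']
      omega
    · have := Finset.sum_sdiff hJI' (f := f)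
      rw [hf, hJ', add_zero] at this
      exact this

theorem disjointBound_prod_zmod (p : ℕ) [Fact p.Prime] :
    DisjointBound (Multiplicative (ZMod p) × Multiplicative (ZMod p)) p (p - 1) := by
  classical
  have hp := (Fact.out : p.Prime)
  let v : Multiplicative (ZMod p) × Multiplicative (ZMod p) → Fin 2 → ZMod p :=
    fun x => ![x.1.toAdd, x.2.toAdd]
  have key : ∀ (l : List (Multiplicative (ZMod p) × Multiplicative (ZMod p)))
      (I : Finset (Fin l.length)), I.Nonempty → ∑ i ∈ I, v l[i] = 0 →
      ∃ l' : List (Multiplicative (ZMod p) × Multiplicative (ZMod p)),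
        l' ≠ [] ∧ l'.prod = 1 ∧ l'.length = I.card ∧ (l' : Multiset (Multiplicative (ZMod p) × Multiplicative (ZMod p))) ≤ ↑l := by
    intro l I hI h0
    refine ⟨I.toList.map fun i => l[i], by simpa using hI.ne_empty, ?_, by simp, ?_⟩
    · rw [Finset.prod_map_toList]
      have e0 := congrFun h0 0
      have e1 := congrFun h0 1
      simp only [Finset.sum_apply, v, Matrix.cons_val, Pi.zero_apply] at e0 e1
      rw [Prod.ext_iff, Prod.fst_prod, Prod.snd_prod]
      refine ⟨Multiplicative.toAdd.injective ?_, Multiplicative.toAdd.injective ?_⟩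
      · rw [toAdd_prod]; exact e0
      · rw [toAdd_prod]; exact e1
    · rw [← Multiset.map_coe, Finset.coe_toList]
      calc I.val.map (fun i => l[i]) ≤ (Finset.univ : Finset (Fin l.length)).val.map
            (fun i => l[i]) := Multiset.map_le_map (Finset.val_le_iff.2 (Finset.subset_univ I))
        _ = l := by simp [Fin.univ_val_map]
  apply disjointBound_of_short
  · intro S hS
    induction S using Quotient.inductionOn with | _ l
    obtain ⟨I, hI, h0⟩ := ZMod.exists_zero_sum_of_card (fun i : Fin l.length => v l[i]) (by
      have := hp.two_le
      simp at hS ⊢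
      omega)
    obtain ⟨l', h₁, h₂, -, h₃⟩ := key l I hI h0
    exact ⟨l', h₁, h₂, h₃⟩
  · intro S hS
    have h2 := hp.two_le
    obtain ⟨T, hTS, hT⟩ := Multiset.exists_le_card_eq_of_le (n := 3 * (p - 1) + 1) (S := S) (by omega)
    induction T using Quotient.inductionOn with | _ l
    obtain ⟨I, hI, hIp, h0⟩ := ZMod.exists_short_zero_sum (fun i : Fin l.length => v l[i]) (by
      simpa using hT)
    obtain ⟨l', h₁, h₂, h₄, h₃⟩ := key l I hI h0
    exact ⟨l', h₁, h₂, by omega, h₃.trans hTS⟩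

end Olson

/-! ### Affine coordinates, blocks, and insertions of blocks. -/

/-- Coordinates on a subgroup of the affine group of `ℤ/q` whose linear parts form a group of
order `p`: a homomorphism `deg` to `ℤ/p`, an embedding `wt` of `ℤ/p` into the units of `ℤ/q` and
the translation part `coc`, a cocycle. -/
structure AffineCoords (G : Type*) [Group G] (p q : ℕ) where
  deg : G → ZMod p
  deg_mul : ∀ x y, deg (x * y) = deg x + deg y
  wt : ZMod p → ZMod q
  wt_zero : wt 0 = 1
  wt_add : ∀ a b, wt (a + b) = wt a * wt b
  wt_injective : Function.Injective wt
  coc : G → ZMod q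
  coc_mul : ∀ x y, coc (x * y) = coc x + wt (deg x) * coc y
  ext : ∀ x y, deg x = deg y → coc x = coc y → x = y

namespace AffineCoords

open scoped Pointwise

variable {G : Type*} [Group G] {p q : ℕ} (D : AffineCoords G p q)

theorem deg_one : D.deg 1 = 0 := by simpa using D.deg_mul 1 1

theorem coc_one : D.coc 1 = 0 := by
  simpa [D.deg_one, D.wt_zero] using D.coc_mul 1 1

theorem deg_append (l₁ l₂ : List G) :
    D.deg (l₁ ++ l₂).prod = D.deg l₁.prod + D.deg l₂.prod := by
  rw [List.prod_append, D.deg_mul]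

theorem deg_prod_perm {l₁ l₂ : List G} (h : l₁.Perm l₂) : D.deg l₁.prod = D.deg l₂.prod := by
  induction h with
  | nil => rfl
  | cons x _ ih => simp [D.deg_mul, ih]
  | swap x y l => simp only [List.prod_cons, D.deg_mul]; ring
  | trans _ _ h₁ h₂ => exact h₁.trans h₂

theorem deg_prod_eq_sum (l : List G) : D.deg l.prod = (l.map D.deg).sum := by
  induction l with
  | nil => exact D.deg_one
  | cons x l ih => simp [D.deg_mul, ih]

theorem eq_one {x : G} (h₁ : D.deg x = 0) (h₂ : D.coc x = 0) : x = 1 :=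
  D.ext x 1 (h₁.trans D.deg_one.symm) (h₂.trans D.coc_one.symm)

theorem wt_mul_wt_neg (a : ZMod p) : D.wt a * D.wt (-a) = 1 := by
  rw [← D.wt_add, add_neg_cancel, D.wt_zero]

theorem wt_ne_zero [Fact q.Prime] (a : ZMod p) : D.wt a ≠ 0 :=
  left_ne_zero_of_mul_eq_one (D.wt_mul_wt_neg a)

/-- The degrees of the proper initial segments of `l`. -/
def prefixes (l : List G) : Finset (ZMod p) :=
  (Finset.range l.length).image fun i => D.deg (l.take i).prod

/-- A nonempty list of total degree zero whose proper initial segments have distinct degrees. -/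
def IsBlock (l : List G) : Prop :=
  l ≠ [] ∧ D.deg l.prod = 0 ∧
    ∀ i j, i < j → j < l.length → D.deg (l.take i).prod ≠ D.deg (l.take j).prod

/-- Every degree in `P` is the degree of some initial segment of `l`. -/
def HasPrefixes (P : Finset (ZMod p)) (l : List G) : Prop :=
  ∀ e ∈ P, ∃ l₁ l₂, l = l₁ ++ l₂ ∧ D.deg l₁.prod = e

variable {D}

theorem IsBlock.card_prefixes {l : List G} (h : D.IsBlock l) :
    (D.prefixes l).card = l.length := by
  rw [prefixes, Finset.card_image_of_injOn, Finset.card_range]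
  intro i hi j hj hij
  simp only [Finset.coe_range, Set.mem_Iio] at hi hj
  rcases lt_trichotomy i j with h' | h' | h'
  · exact absurd hij (h.2.2 i j h' hj)
  · exact h'
  · exact absurd hij.symm (h.2.2 j i h' hi)

theorem IsBlock.length_pos {l : List G} (h : D.IsBlock l) : 0 < l.length :=
  List.length_pos_iff.2 h.1

theorem IsBlock.length_le [NeZero p] {l : List G} (h : D.IsBlock l) : l.length ≤ p := by
  rw [← h.card_prefixes]
  simpa [ZMod.card] using Finset.card_le_univ (D.prefixes l)

theorem IsBlock.prefixes_nonempty {l : List G} (h : D.IsBlock l) : (D.prefixes l).Nonempty := by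
  rw [← Finset.card_pos, h.card_prefixes]
  exact h.length_pos

theorem hasPrefixes_prefixes (l : List G) : D.HasPrefixes (D.prefixes l) l := by
  intro e he
  obtain ⟨i, -, rfl⟩ := Finset.mem_image.1 he
  exact ⟨l.take i, l.drop i, (List.take_append_drop i l).symm, rfl⟩

theorem hasPrefixes_zero (l : List G) : D.HasPrefixes {0} l := by
  intro e he
  rw [Finset.mem_singleton.1 he]
  exact ⟨[], l, rfl, D.deg_one⟩

/-- Moving an initial segment of degree `f` to the end conjugates the product by that segment. As
the product is a translation, this only scales it by `D.wt (-f)`. -/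
theorem exists_rotation {T : List G} (hT : D.deg T.prod = 0) {f : ZMod p}
    (hf : f ∈ D.prefixes T) :
    ∃ T' : List G, T'.Perm T ∧ D.coc T'.prod = D.wt (-f) * D.coc T.prod := by
  obtain ⟨i, -, rfl⟩ := Finset.mem_image.1 hf
  refine ⟨T.drop i ++ T.take i, ?_, ?_⟩
  · refine List.perm_append_comm.trans ?_
    rw [List.take_append_drop]
  · have h₁ : D.deg (T.take i).prod + D.deg (T.drop i).prod = 0 := by
      rw [← D.deg_append, List.take_append_drop, hT]
    have h₂ : D.coc T.prod = D.coc (T.take i).prod +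
        D.wt (D.deg (T.take i).prod) * D.coc (T.drop i).prod := by
      rw [← D.coc_mul, List.prod_take_mul_prod_drop]
    rw [h₂, List.prod_append, D.coc_mul, eq_neg_of_add_eq_zero_right h₁, mul_add, ← mul_assoc,
      mul_comm (D.wt (-_)) (D.wt _), D.wt_mul_wt_neg]
    ring

/-- Rotate `T` by `f` and insert it after an initial segment of `L` of degree `e`; its translation
is then scaled by `D.wt e * D.wt (-f)`. As `T` has degree zero, the prefix degrees in `P` survive,
so further insertions remain possible. -/
theorem exists_insertion {P : Finset (ZMod p)} {L T : List G} (hL : D.HasPrefixes P L)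
    (hT : D.deg T.prod = 0) {e f : ZMod p} (he : e ∈ P) (hf : f ∈ D.prefixes T) :
    ∃ L' : List G, L'.Perm (L ++ T) ∧ D.HasPrefixes P L' ∧
      D.coc L'.prod = D.coc L.prod + D.wt (e - f) * D.coc T.prod := by
  obtain ⟨T', hT', hc⟩ := exists_rotation hT hf
  have hd : D.deg T'.prod = 0 := (D.deg_prod_perm hT').trans hT
  obtain ⟨l₁, l₂, rfl, rfl⟩ := hL e he
  refine ⟨l₁ ++ (T' ++ l₂), ?_, ?_, ?_⟩
  · rw [List.append_assoc]
    exact (List.perm_append_comm.trans (hT'.append_left _)).append_left _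
  · intro e' he'
    obtain ⟨m₁, m₂, hm, rfl⟩ := hL e' he'
    rcases List.append_eq_append_iff.1 hm with ⟨a, rfl, rfl⟩ | ⟨a, rfl, rfl⟩
    · exact ⟨l₁ ++ (T' ++ a), m₂, by simp, by simp [D.deg_mul, hd]⟩
    · exact ⟨m₁, a ++ (T' ++ l₂), by simp, rfl⟩
  · simp only [List.prod_append, D.coc_mul, hd, D.wt_zero, hc, sub_eq_add_neg, D.wt_add]
    ring

variable (D) in
/-- The possible changes of `coc` when a block `T` is inserted or not. -/
def options (P : Finset (ZMod p)) (T : List G) : Finset (ZMod q) :=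
  insert 0 ((P - D.prefixes T).image fun d => D.wt d * D.coc T.prod)

theorem exists_insertions {P : Finset (ZMod p)} (Ts : List (List G)) :
    ∀ L : List G, D.HasPrefixes P L → (∀ T ∈ Ts, D.deg T.prod = 0) →
      ∀ v ∈ (Ts.map (D.options P)).sum, ∃ L' : List G, (L : Multiset G) ≤ L' ∧
        (L' : Multiset G) ≤ (L ++ Ts.flatten : List G) ∧ D.deg L'.prod = D.deg L.prod ∧
        D.coc L'.prod = D.coc L.prod + v := by
  induction Ts with
  | nil =>
    intro L _ _ v hv
    have : v = 0 := by simpa using hv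
    exact ⟨L, le_rfl, by simp, rfl, by simp [this]⟩
  | cons T Ts ih =>
    intro L hL hT v hv
    rw [List.map_cons, List.sum_cons, Finset.mem_add] at hv
    obtain ⟨y, hy, z, hz, rfl⟩ := hv
    have hT' : ∀ T ∈ Ts, D.deg T.prod = 0 := fun U hU => hT U (by simp [hU])
    rcases Finset.mem_insert.1 hy with rfl | hy
    · obtain ⟨L', h₁, h₂, h₃, h₄⟩ := ih L hL hT' z hz
      refine ⟨L', h₁, h₂.trans ?_, h₃, by rw [h₄, zero_add]⟩
      rw [List.flatten_cons, ← Multiset.coe_add, ← Multiset.coe_add, ← Multiset.coe_add]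
      gcongr
      exact Multiset.le_add_left _ _
    · obtain ⟨d, hd, rfl⟩ := Finset.mem_image.1 hy
      obtain ⟨e, he, f, hf, rfl⟩ := Finset.mem_sub.1 hd
      obtain ⟨M, hM, hMP, hMc⟩ := exists_insertion hL (hT T (by simp)) he hf
      obtain ⟨L', h₁, h₂, h₃, h₄⟩ := ih M hMP hT' z hz
      have hM' : (M : Multiset G) = L + T := by
        rw [Multiset.coe_add]
        exact Multiset.coe_eq_coe.2 hM
      refine ⟨L', ?_, ?_, ?_, by rw [h₄, hMc, add_assoc]⟩
      · exact (hM' ▸ Multiset.le_add_right _ _ : (L : Multiset G) ≤ M).trans h₁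
      · refine h₂.trans (le_of_eq ?_)
        rw [List.flatten_cons, ← Multiset.coe_add, ← Multiset.coe_add, ← Multiset.coe_add, hM',
          add_assoc]
      · rw [h₃, D.deg_prod_perm hM, D.deg_append, hT T (by simp), add_zero]

/-- Cauchy–Davenport in `ℤ/p` counts the differences `e - f`. Distinct differences give distinct
nonzero translations since `D.wt` is injective and `D.coc T.prod ≠ 0`; omitting the block adds the
value `0`. -/
theorem card_options [Fact p.Prime] [Fact q.Prime] {P : Finset (ZMod p)} (hP : P.Nonempty)
    {T : List G} (hT : D.IsBlock T) (hc : D.coc T.prod ≠ 0) :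
    min p (P.card + T.length - 1) ≤ (D.options P T).card - 1 := by
  rw [options, Finset.card_insert_of_notMem, Nat.add_sub_cancel, Finset.card_image_of_injective]
  · have := ZMod.cauchy_davenport (Fact.out : p.Prime) hP hT.prefixes_nonempty.neg
    rw [Finset.card_neg, hT.card_prefixes, ← sub_eq_add_neg] at this
    exact this
  · intro a b hab
    exact D.wt_injective (mul_right_cancel₀ hc hab)
  · intro h0
    obtain ⟨d, -, hd⟩ := Finset.mem_image.1 h0
    exact mul_ne_zero (D.wt_ne_zero d) hc hd

theorem sum_le_of_options [Fact p.Prime] [Fact q.Prime] {P : Finset (ZMod p)} (hP : P.Nonempty)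
    {Ts : List (List G)} (hT : ∀ T ∈ Ts, D.IsBlock T) (hc : ∀ T ∈ Ts, D.coc T.prod ≠ 0) :
    (Ts.map fun T => min p (P.card + T.length - 1)).sum ≤
      ((Ts.map (D.options P)).map fun A => A.card - 1).sum := by
  rw [List.map_map]
  exact List.sum_le_sum fun T h => card_options hP (hT T h) (hc T h)

theorem exists_prod_eq_one_of_coc_eq_zero {Ts : List (List G)} (hT : ∀ T ∈ Ts, D.IsBlock T)
    (hc : ¬ ∀ T ∈ Ts, D.coc T.prod ≠ 0) :
    ∃ l : List G, l ≠ [] ∧ l.prod = 1 ∧ (l : Multiset G) ≤ (Ts.flatten : List G) := by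
  push Not at hc
  obtain ⟨T, hT', h0⟩ := hc
  exact ⟨T, (hT T hT').1, D.eq_one (hT T hT').2.1 h0,
    Multiset.coe_le.2 (List.sublist_flatten_of_mem hT').subperm⟩

/-- Blocks inserted at all places of a first block `T`. -/
theorem exists_prod_eq_one_of_insertions [Fact p.Prime] [Fact q.Prime] {T : List G}
    {Ts : List (List G)} (hTs : ∀ U ∈ T :: Ts, D.IsBlock U)
    (h : q ≤ 1 + (Ts.map fun U => min p (T.length + U.length - 1)).sum) :
    ∃ l : List G, l ≠ [] ∧ l.prod = 1 ∧ (l : Multiset G) ≤ ((T :: Ts).flatten : List G) := by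
  by_cases hc : ∀ U ∈ T :: Ts, D.coc U.prod ≠ 0
  swap
  · exact exists_prod_eq_one_of_coc_eq_zero hTs hc
  have hT : D.IsBlock T := hTs T (by simp)
  have hTs' : ∀ U ∈ Ts, D.IsBlock U := fun U hU => hTs U (by simp [hU])
  have h₁ := sum_le_of_options hT.prefixes_nonempty hTs' fun U hU => hc U (by simp [hU])
  rw [hT.card_prefixes] at h₁
  have h₂ := ZMod.sum_eq_univ (Fact.out : q.Prime) (Finset.singleton_nonempty (D.coc T.prod))
    (As := Ts.map (D.options (D.prefixes T))) (by
      intro A hA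
      obtain ⟨U, -, rfl⟩ := List.mem_map.1 hA
      exact Finset.insert_nonempty _ _) (by
      rw [Finset.card_singleton]
      exact h.trans (by gcongr))
  -- The reachable translations fill `ℤ/q`, so `0` is one of them. The list realizing it contains
  -- `T`, hence is nonempty.
  have h₃ : (0 : ZMod q) ∈ {D.coc T.prod} + (Ts.map (D.options (D.prefixes T))).sum := by
    rw [h₂]
    exact Finset.mem_univ _
  obtain ⟨x, hx, v, hv, hxv⟩ := Finset.mem_add.1 h₃
  rw [Finset.mem_singleton] at hx
  subst hx
  obtain ⟨L', k₁, k₂, k₃, k₄⟩ :=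
    exists_insertions Ts T (hasPrefixes_prefixes T) (fun U hU => (hTs' U hU).2.1) v hv
  refine ⟨L', ?_, D.eq_one (k₃.trans hT.2.1) (k₄.trans hxv), k₂⟩
  rintro rfl
  exact hT.1 (by simpa using k₁)

/-- Blocks of total length at least `q` contain a product-one subsequence. -/
theorem exists_prod_eq_one_of_length [Fact p.Prime] [Fact q.Prime] {Ts : List (List G)}
    (hTs : ∀ U ∈ Ts, D.IsBlock U) (h : q ≤ Ts.flatten.length) :
    ∃ l : List G, l ≠ [] ∧ l.prod = 1 ∧ (l : Multiset G) ≤ (Ts.flatten : List G) := by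
  by_cases hc : ∀ U ∈ Ts, D.coc U.prod ≠ 0
  swap
  · exact exists_prod_eq_one_of_coc_eq_zero hTs hc
  cases Ts with
  | nil => exact absurd h (by simpa using (Fact.out : q.Prime).pos.ne')
  | cons T Ts =>
  have hT : D.IsBlock T := hTs T (by simp)
  have hTs' : ∀ U ∈ Ts, D.IsBlock U := fun U hU => hTs U (by simp [hU])
  have h₁ := sum_le_of_options (Finset.singleton_nonempty (0 : ZMod p)) hTs'
    fun U hU => hc U (by simp [hU])
  have h₀ : Ts.map List.length = Ts.map fun U => min p (({0} : Finset (ZMod p)).card + U.length - 1) := by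
    refine List.map_congr_left fun U hU => ?_
    have := (hTs' U hU).length_le
    rw [Finset.card_singleton, Nat.add_sub_cancel_left, min_eq_right this]
  rw [← h₀] at h₁
  -- The rotations of the first block give `T.length` values. Every other block is inserted only at
  -- the beginning, as one of its own rotations, and contributes its length to Cauchy–Davenport.
  let R : Finset (ZMod q) := (D.prefixes T).image fun f => D.wt (-f) * D.coc T.prod
  have hR : R.card = T.length := by
    rw [← hT.card_prefixes]
    refine Finset.card_image_of_injective _ fun a b hab => ?_
    exact neg_injective (D.wt_injective (mul_right_cancel₀ (hc T (by simp)) hab))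
  have h₂ := ZMod.sum_eq_univ (Fact.out : q.Prime) (D := R) (by
      rw [← Finset.card_pos, hR]
      exact hT.length_pos)
    (As := Ts.map (D.options {0})) (by
      intro A hA
      obtain ⟨U, -, rfl⟩ := List.mem_map.1 hA
      exact Finset.insert_nonempty _ _) (by
      rw [hR]
      rw [List.flatten_cons, List.length_append, List.length_flatten] at h
      exact h.trans (by gcongr))
  have h₃ : (0 : ZMod q) ∈ R + (Ts.map (D.options {0})).sum := by
    rw [h₂]
    exact Finset.mem_univ _
  obtain ⟨x, hx, v, hv, hxv⟩ := Finset.mem_add.1 h₃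
  obtain ⟨f, hf, rfl⟩ := Finset.mem_image.1 hx
  obtain ⟨T', hT', hc'⟩ := exists_rotation hT.2.1 hf
  obtain ⟨L', k₁, k₂, k₃, k₄⟩ :=
    exists_insertions Ts T' (hasPrefixes_zero T') (fun U hU => (hTs' U hU).2.1) v hv
  have hT'' : (T' : Multiset G) = T := Multiset.coe_eq_coe.2 hT'
  refine ⟨L', ?_, D.eq_one (k₃.trans ((D.deg_prod_perm hT').trans hT.2.1))
    (by rw [k₄, hc', hxv]), ?_⟩
  · rintro rfl
    rw [hT''] at k₁
    exact hT.1 (by simpa using k₁)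
  · rw [List.flatten_cons, ← Multiset.coe_add]
    rw [← Multiset.coe_add, hT''] at k₂
    exact k₂

/-- A shortest nonempty list of degree zero is a block: if two proper initial segments had equal
degree, the terms between them could be cut out. -/
theorem exists_isBlock {S : Multiset G} {m : ℕ}
    (h : ∃ l : List G, l ≠ [] ∧ (l : Multiset G) ≤ S ∧ D.deg l.prod = 0 ∧ l.length ≤ m) :
    ∃ T : List G, D.IsBlock T ∧ T.length ≤ m ∧ (T : Multiset G) ≤ S := by
  classical
  have hex : ∃ n, ∃ l : List G, (l ≠ [] ∧ (l : Multiset G) ≤ S ∧ D.deg l.prod = 0) ∧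
      l.length = n := by
    obtain ⟨l, h₁, h₂, h₃, -⟩ := h
    exact ⟨_, l, ⟨h₁, h₂, h₃⟩, rfl⟩
  obtain ⟨T, ⟨h₁, h₂, h₃⟩, hlen⟩ := Nat.find_spec hex
  refine ⟨T, ⟨h₁, h₃, fun i j hij hj he => ?_⟩, ?_, h₂⟩
  · have hsub : (T.take i ++ T.drop j).Sublist T := by
      conv_rhs => rw [← List.take_append_drop j T]
      exact (List.take_sublist_take_left hij.le).append_right _
    refine Nat.find_min hex (m := (T.take i ++ T.drop j).length) ?_
      ⟨T.take i ++ T.drop j, ⟨?_, (Multiset.coe_le.2 hsub.subperm).trans h₂, ?_⟩, rfl⟩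
    · rw [← hlen]
      simp only [List.length_append, List.length_take, List.length_drop]
      omega
    · rw [← List.length_pos_iff]
      simp only [List.length_append, List.length_take, List.length_drop]
      omega
    · rw [D.deg_append, he, ← D.deg_append, List.take_append_drop, h₃]
  · obtain ⟨l, k₁, k₂, k₃, k₄⟩ := h
    rw [hlen]
    exact (Nat.find_min' hex ⟨l, ⟨k₁, k₂, k₃⟩, rfl⟩).trans k₄

/-- A maximal family of disjoint blocks of length at most `m`. -/
theorem exists_maximal_blocks [DecidableEq G] (D : AffineCoords G p q) (m : ℕ) (S : Multiset G) :
    ∃ Bs : List (List G), (∀ T ∈ Bs, D.IsBlock T ∧ T.length ≤ m) ∧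
      (Bs.flatten : Multiset G) ≤ S ∧
      ∀ l : List G, l ≠ [] → (l : Multiset G) ≤ S - (Bs.flatten : Multiset G) →
        D.deg l.prod = 0 → m < l.length := by
  induction hn : S.card using Nat.strong_induction_on generalizing S with | _ n ih
  by_cases h : ∃ l : List G, l ≠ [] ∧ (l : Multiset G) ≤ S ∧ D.deg l.prod = 0 ∧ l.length ≤ m
  · obtain ⟨T, hT, hm, hle⟩ := exists_isBlock h
    have hpos := hT.length_pos
    have hc := Multiset.card_le_card hle
    obtain ⟨Bs, h₁, h₂, h₃⟩ := ih _ (by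
      rw [Multiset.card_sub hle]
      simp only [Multiset.coe_card] at hc ⊢
      omega) (S - (T : Multiset G)) rfl
    refine ⟨T :: Bs, ?_, ?_, ?_⟩
    · rintro U (_ | ⟨_, hU⟩)
      · exact ⟨hT, hm⟩
      · exact h₁ U hU
    · rw [List.flatten_cons, ← Multiset.coe_add]
      calc (T : Multiset G) + Bs.flatten ≤ T + (S - T) := by gcongr
        _ = S := add_tsub_cancel_of_le hle
    · intro l
      rw [List.flatten_cons, ← Multiset.coe_add, ← tsub_tsub]
      exact h₃ l
  · push Not at h
    exact ⟨[], by simp, by simp, fun l h₁ h₂ h₃ => h l h₁ (by simpa using h₂) h₃⟩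

end AffineCoords

/-! ### Short zero-sum subsequences in `ℤ/p`. -/

section ZeroSum

open scoped Pointwise

theorem card_sum_map_val {α : Type*} (As : List (Finset α)) :
    (As.map Finset.val).sum.card = (As.map Finset.card).sum := by
  induction As with
  | nil => rfl
  | cons A As ih => simp [ih]

theorem exists_list_of_mem_sum_insert_zero {α : Type*} [DecidableEq α] [AddCommMonoid α]
    (As : List (Finset α)) :
    ∀ v ∈ (As.map (insert 0)).sum, ∃ l : List α, (l : Multiset α) ≤ (As.map Finset.val).sum ∧
      l.length ≤ As.length ∧ l.sum = v := by
  induction As with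
  | nil =>
    intro v hv
    exact ⟨[], by simp, by simp, (by simpa using hv : v = 0).symm⟩
  | cons A As ih =>
    intro v hv
    rw [List.map_cons, List.sum_cons, Finset.mem_add] at hv
    obtain ⟨y, hy, z, hz, rfl⟩ := hv
    obtain ⟨l, h₁, h₂, rfl⟩ := ih z hz
    rw [List.map_cons, List.sum_cons]
    rcases Finset.mem_insert.1 hy with rfl | hy
    · exact ⟨l, h₁.trans (Multiset.le_add_left _ _), by simp; omega, by simp⟩
    · refine ⟨y :: l, ?_, by simpa using h₂, by simp⟩
      rw [← Multiset.cons_coe, ← Multiset.singleton_add]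
      exact add_le_add (Multiset.singleton_le.2 hy) h₁

/-- Split `J` into `m` sets and choose one element from the first and at most one from each of the
others. If `0 ∉ J`, adjoining `0` to a set of size `c` gives size `c + 1`, so Cauchy–Davenport
yields `min p J.card = p` sums. -/
theorem ZMod.exists_short_zero_sum_of_count_le {p m : ℕ} [Fact p.Prime] {J : Multiset (ZMod p)}
    (hm : 0 < m) (hmp : m ≤ p) (hJ : p ≤ J.card) (hc : ∀ a, J.count a ≤ m) :
    ∃ l : List (ZMod p), l ≠ [] ∧ (l : Multiset (ZMod p)) ≤ J ∧ l.sum = 0 ∧ l.length ≤ m := by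
  obtain ⟨As, h₁, h₂, rfl⟩ := Multiset.exists_partition_finsets m J (hmp.trans hJ) hc
  by_cases h0 : (0 : ZMod p) ∈ (As.map Finset.val).sum
  · exact ⟨[0], by simp, by simpa using h0, by simp, hm⟩
  cases As with
  | nil => simp at h₁; omega
  | cons A As =>
  have hcard : p ≤ A.card + ((As.map (insert 0)).map fun B : Finset (ZMod p) => B.card - 1).sum := by
    have : (As.map (insert 0)).map (fun B : Finset (ZMod p) => B.card - 1) =
        As.map fun B => Multiset.card B.val := by
      rw [List.map_map]
      refine List.map_congr_left fun B hB => ?_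
      have : (0 : ZMod p) ∉ B := fun h => h0 (by
        rw [List.map_cons, List.sum_cons, Multiset.mem_add]
        right
        exact Multiset.mem_of_le (List.single_le_sum (by simp) _ (List.mem_map_of_mem hB)) h)
      simp [this]
    rw [this]
    have h3 := hJ
    rw [List.map_cons, List.sum_cons, Multiset.card_add, card_sum_map_val] at h3
    exact h3
  have hu := ZMod.sum_eq_univ (Fact.out : p.Prime) (h₂ A (by simp)) (by
    intro B hB
    obtain ⟨C, -, rfl⟩ := List.mem_map.1 hB
    exact Finset.insert_nonempty _ _) hcard
  have h₃ : (0 : ZMod p) ∈ A + (As.map (insert 0)).sum := by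
    rw [hu]
    exact Finset.mem_univ _
  obtain ⟨x, hx, v, hv, hxv⟩ := Finset.mem_add.1 h₃
  obtain ⟨l, k₁, k₂, rfl⟩ := exists_list_of_mem_sum_insert_zero As v hv
  refine ⟨x :: l, by simp, ?_, by simpa using hxv, ?_⟩
  · rw [List.map_cons, List.sum_cons, ← Multiset.cons_coe, ← Multiset.singleton_add]
    exact add_le_add (Multiset.singleton_le.2 hx) k₁
  · simp only [List.length_cons] at h₁ ⊢
    omega

theorem ZMod.exists_short_zero_sum_of_count {p m : ℕ} [Fact p.Prime] {J : Multiset (ZMod p)}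
    (hm : p + 1 = 2 * m) (hJ : p ≤ J.card) (hc : ∀ a, J.count a + m ≤ J.card + 1) :
    ∃ l : List (ZMod p), l ≠ [] ∧ (l : Multiset (ZMod p)) ≤ J ∧ l.sum = 0 ∧ l.length ≤ m := by
  have hp := (Fact.out : p.Prime).two_le
  by_cases h : ∀ a, J.count a ≤ m
  · exact ZMod.exists_short_zero_sum_of_count_le (by omega) (by omega) hJ h
  · push Not at h
    obtain ⟨j, hj⟩ := h
    have hsplit := Multiset.filter_add_not (· = j) J
    rw [Multiset.filter_eq'] at hsplit
    -- If `j` occurs more than `m` times, pass to `m` copies of `j` and `m - 1` other terms: that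
    -- makes `2 * m - 1 = p` terms with all multiplicities at most `m`.
    have hcard := congrArg Multiset.card hsplit
    rw [Multiset.card_add, Multiset.card_replicate] at hcard
    have hcj := hc j
    obtain ⟨O, hO, hOc⟩ := Multiset.exists_le_card_eq_of_le (n := m - 1)
      (S := J.filter fun x => ¬ x = j) (by omega)
    have hle : Multiset.replicate m j + O ≤ J := by
      conv_rhs => rw [← hsplit]
      exact add_le_add (Multiset.replicate_le_replicate j |>.2 hj.le) hO
    obtain ⟨l, h₁, h₂, h₃, h₄⟩ := ZMod.exists_short_zero_sum_of_count_le (p := p) (m := m)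
      (J := Multiset.replicate m j + O) (by omega) (by omega)
      (by rw [Multiset.card_add, Multiset.card_replicate]; omega) (by
        intro a
        rw [Multiset.count_add, Multiset.count_replicate]
        split_ifs with ha
        · subst ha
          have : O.count j = 0 := Multiset.count_eq_zero.2 fun h =>
            (Multiset.mem_filter.1 (Multiset.mem_of_le hO h)).2 rfl
          omega
        · have := Multiset.count_le_card a O
          omega)
    exact ⟨l, h₁, h₂.trans hle, h₃, h₄⟩

end ZeroSum

/-! ### Terms of a single degree, and unrestricted product-one subsequences. -/

namespace AffineCoords

open scoped Pointwise

variable {G : Type*} [Group G] {p q : ℕ} {D : AffineCoords G p q}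

theorem exists_short_deg_zero [Fact p.Prime] {m : ℕ} {R : Multiset G}
    (hm : p + 1 = 2 * m) (hR : p ≤ R.card)
    (hc : ∀ j, (R.map D.deg).count j + m ≤ R.card + 1) :
    ∃ l : List G, l ≠ [] ∧ (l : Multiset G) ≤ R ∧ D.deg l.prod = 0 ∧ l.length ≤ m := by
  obtain ⟨l, h₁, h₂, h₃, h₄⟩ := ZMod.exists_short_zero_sum_of_count hm (J := R.map D.deg)
    (by simpa using hR) (by simpa using hc)
  obtain ⟨l', rfl, hle⟩ := exists_list_lift _ _ _ h₂
  exact ⟨l', by simpa using h₁, hle, by rw [D.deg_prod_eq_sum, h₃], by simpa using h₄⟩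

theorem deg_prod_of_forall {l : List G} {j : ZMod p} (h : ∀ x ∈ l, D.deg x = j) :
    D.deg l.prod = l.length * j := by
  rw [D.deg_prod_eq_sum, List.map_eq_replicate_iff.2 h, List.sum_replicate, nsmul_eq_mul]

theorem isBlock_of_forall [Fact p.Prime] {l : List G} {j : ZMod p} (hj : j ≠ 0)
    (hl : l.length = p) (h : ∀ x ∈ l, D.deg x = j) : D.IsBlock l := by
  have hp := (Fact.out : p.Prime).pos
  refine ⟨List.length_pos_iff.1 (hl ▸ hp), ?_, fun i k hik hk he => ?_⟩
  · rw [deg_prod_of_forall h, hl, ZMod.natCast_self, zero_mul]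
  · rw [deg_prod_of_forall fun x hx => h x (List.mem_of_mem_take hx),
      deg_prod_of_forall fun x hx => h x (List.mem_of_mem_take hx)] at he
    have h1 := mul_right_cancel₀ hj he
    rw [ZMod.natCast_eq_natCast_iff', List.length_take, List.length_take,
      Nat.mod_eq_of_lt (by omega), Nat.mod_eq_of_lt (by omega)] at h1
    omega

theorem isBlock_singleton {x : G} (hx : D.deg x = 0) : D.IsBlock [x] := by
  refine ⟨by simp, by simpa using hx, fun i k hik hk => ?_⟩
  simp at hk
  omega

/-- The translation `x ^ p` commutes with `x`, whose linear part `D.wt (D.deg x)` is not `1`; only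
the trivial translation does so. -/
theorem pow_eq_one_of_deg_ne_zero [Fact q.Prime] {x : G} (hx : D.deg x ≠ 0) : x ^ p = 1 := by
  have hdeg : D.deg (x ^ p) = 0 := by
    rw [← List.prod_replicate, deg_prod_of_forall (j := D.deg x) (fun y hy => by
      rw [List.eq_of_mem_replicate hy])]
    simp
  refine D.eq_one hdeg ?_
  have h := congrArg D.coc (pow_mul_comm' x p)
  rw [D.coc_mul, D.coc_mul, hdeg, D.wt_zero] at h
  have h' : (D.wt (D.deg x) - 1) * D.coc (x ^ p) = 0 := by linear_combination -h
  refine (mul_eq_zero.1 h').resolve_left fun h0 => hx (D.wt_injective ?_)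
  rw [D.wt_zero]
  exact sub_eq_zero.1 h0

/-- The translation parts of the products `x₁ ⋯ xₘ` with `xᵢ ∈ Aᵢ`. -/
theorem exists_transversal_values [Fact q.Prime] {j : ZMod p} (As : List (Finset G))
    (h₀ : ∀ A ∈ As, A.Nonempty) (hj : ∀ A ∈ As, ∀ x ∈ A, D.deg x = j) :
    ∃ V : Finset (ZMod q), V.Nonempty ∧ min q (1 + (As.map fun A => A.card - 1).sum) ≤ V.card ∧
      ∀ v ∈ V, ∃ l : List G, (l : Multiset G) ≤ (As.map Finset.val).sum ∧ l.length = As.length ∧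
        (∀ x ∈ l, D.deg x = j) ∧ D.coc l.prod = v := by
  induction As with
  | nil =>
    refine ⟨{0}, by simp, by simp, fun v hv => ⟨[], by simp, rfl, by simp, ?_⟩⟩
    rw [Finset.mem_singleton.1 hv]
    exact D.coc_one
  | cons A As ih =>
    obtain ⟨V, hV, hc, hl⟩ := ih (fun B hB => h₀ B (by simp [hB])) fun B hB => hj B (by simp [hB])
    have hA := h₀ A (by simp)
    have hA' := hj A (by simp)
    refine ⟨A.image D.coc + V.image (D.wt j * ·), (hA.image _).add (hV.image _), ?_, ?_⟩
    · have h₁ := ZMod.cauchy_davenport (Fact.out : q.Prime) (hA.image D.coc)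
        (hV.image (D.wt j * ·))
      rw [Finset.card_image_of_injOn, Finset.card_image_of_injective _
        (mul_right_injective₀ (D.wt_ne_zero j))] at h₁
      · have := hA.card_pos
        rw [List.map_cons, List.sum_cons]
        omega
      · intro x hx y hy hxy
        exact D.ext x y ((hA' x hx).trans (hA' y hy).symm) hxy
    · intro v hv
      obtain ⟨y, hy, z, hz, rfl⟩ := Finset.mem_add.1 hv
      obtain ⟨x, hx, rfl⟩ := Finset.mem_image.1 hy
      obtain ⟨u, hu, rfl⟩ := Finset.mem_image.1 hz
      obtain ⟨l, k₁, k₂, k₃, rfl⟩ := hl u hu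
      refine ⟨x :: l, ?_, by simp [k₂], ?_, ?_⟩
      · rw [List.map_cons, List.sum_cons, ← Multiset.cons_coe, ← Multiset.singleton_add]
        exact add_le_add (Multiset.singleton_le.2 hx) k₁
      · rintro y (_ | ⟨_, hy⟩)
        · exact hA' x hx
        · exact k₃ y hy
      · rw [List.prod_cons, D.coc_mul, hA' x hx]

/-- An Erdős–Ginzburg–Ziv argument. If no term occurs more than `p` times, split `W` into `p` sets;
the products of transversals take at least `min q (W.card - p + 1) = q` translation values. A term
occurring more often satisfies `x ^ p = 1`. -/
theorem exists_prod_eq_one_of_deg_eq [Fact p.Prime] [Fact q.Prime] {j : ZMod p} (hj : j ≠ 0)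
    {W : Multiset G} (hW : ∀ x ∈ W, D.deg x = j) (hc : q + p ≤ W.card + 1) :
    ∃ l : List G, l ≠ [] ∧ l.prod = 1 ∧ l.length = p ∧ (l : Multiset G) ≤ W := by
  classical
  have hp := (Fact.out : p.Prime).pos
  have hq := (Fact.out : q.Prime).two_le
  by_cases hcount : ∀ x, W.count x ≤ p
  · obtain ⟨As, h₁, h₂, rfl⟩ := Multiset.exists_partition_finsets p W (by omega) hcount
    obtain ⟨V, -, hV, hl⟩ := exists_transversal_values (D := D) (j := j) As h₂ fun A hA x hx =>
      hW x (Multiset.mem_of_le (List.single_le_sum (by simp) _ (List.mem_map_of_mem hA)) hx)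
    have hsum : ∀ As : List (Finset G), (∀ A ∈ As, A.Nonempty) →
        (As.map fun A => A.card - 1).sum + As.length = (As.map Finset.card).sum := by
      intro As
      induction As with
      | nil => simp
      | cons A As ih =>
        intro hA
        have h3 := (hA A (by simp)).card_pos
        have h4 := ih fun B hB => hA B (by simp [hB])
        simp only [List.map_cons, List.sum_cons, List.length_cons]
        omega
    have h3 := hsum As h₂
    rw [card_sum_map_val] at hc
    have hV' : V = Finset.univ := by
      apply Finset.eq_univ_of_card
      have := Finset.card_le_univ V
      rw [ZMod.card] at this ⊢
      omega
    obtain ⟨l, k₁, k₂, k₃, k₄⟩ := hl 0 (hV' ▸ Finset.mem_univ _)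
    have hlp : l.length = p := k₂.trans h₁
    have hb := isBlock_of_forall hj hlp k₃
    exact ⟨l, hb.1, D.eq_one hb.2.1 k₄, hlp, k₁⟩
  · push Not at hcount
    obtain ⟨x, hx⟩ := hcount
    have hxW : x ∈ W := Multiset.count_pos.1 (by omega)
    refine ⟨List.replicate p x, ?_, ?_, by simp, ?_⟩
    · simpa using hp.ne'
    · rw [List.prod_replicate]
      exact pow_eq_one_of_deg_ne_zero (D := D) (by rwa [hW x hxW])
    · rw [Multiset.coe_replicate]
      exact Multiset.le_count_iff_replicate_le.1 hx.le

theorem exists_prod_eq_one_of_deg_eq_zero [Fact p.Prime] [Fact q.Prime] {W : Multiset G}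
    (hW : ∀ x ∈ W, D.deg x = 0) (hc : q ≤ W.card) :
    ∃ l : List G, l ≠ [] ∧ l.prod = 1 ∧ l.length ≤ q ∧ (l : Multiset G) ≤ W := by
  obtain ⟨W', hW', hc'⟩ := Multiset.exists_le_card_eq_of_le hc
  induction W' using Quotient.inductionOn with | _ w
  have hfl : (w.map fun x => [x]).flatten = w := by
    clear hW' hc'
    induction w with
    | nil => rfl
    | cons x w ih => simp [ih]
  obtain ⟨l, h₁, h₂, h₃⟩ := exists_prod_eq_one_of_length (D := D) (Ts := w.map fun x => [x]) (by
      intro U hU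
      obtain ⟨x, hx, rfl⟩ := List.mem_map.1 hU
      exact isBlock_singleton (hW x (Multiset.mem_of_le hW' hx))) (by
      rw [hfl]
      exact hc'.ge)
  rw [hfl] at h₃
  exact ⟨l, h₁, h₂, by simpa using (Multiset.card_le_card h₃).trans hc'.le, h₃.trans hW'⟩

/-- A sequence of length `q + p - 1` has a product-one subsequence. -/
theorem exists_prod_eq_one [Fact p.Prime] [Fact q.Prime] (D : AffineCoords G p q)
    {S : Multiset G} (hS : q + p ≤ S.card + 1) :
    ∃ l : List G, l ≠ [] ∧ l.prod = 1 ∧ (l : Multiset G) ≤ S := by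
  classical
  have hp := (Fact.out : p.Prime).pos
  obtain ⟨Bs, h₁, h₂, h₃⟩ := exists_maximal_blocks D p S
  -- Any `p` leftover terms would contain a zero-sum of degrees of length at most `p`, against
  -- maximality. So the blocks cover at least `q` terms.
  have hR : (S - (Bs.flatten : Multiset G)).card < p := by
    by_contra hR
    obtain ⟨R, hR₁, hR₂⟩ := Multiset.exists_le_card_eq_of_le (not_lt.1 hR)
    obtain ⟨J, k₁, k₂, k₃, k₄⟩ := ZMod.exists_short_zero_sum_of_count_le (p := p) (m := p)
      (J := R.map D.deg) hp le_rfl (by simp [hR₂])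
      (fun a => (Multiset.count_le_card _ _).trans (by simp [hR₂]))
    obtain ⟨l, rfl, hl⟩ := exists_list_lift _ _ _ k₂
    have := h₃ l (by simpa using k₁) (hl.trans hR₁) (by rw [D.deg_prod_eq_sum, k₃])
    simp at k₄
    omega
  rw [Multiset.card_sub h₂, Multiset.coe_card] at hR
  obtain ⟨l, k₁, k₂, k₃⟩ := exists_prod_eq_one_of_length (fun U hU => (h₁ U hU).1) (by omega)
  exact ⟨l, k₁, k₂, k₃.trans h₂⟩

end AffineCoords

/-! ### Product-one subsequences of length at most `q`. -/

theorem List.exists_split_sum_ge {α : Type*} (f : α → ℕ) {N : ℕ} (hN : 0 < N) (l : List α)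
    (h : N ≤ (l.map f).sum) :
    ∃ l₁ a l₂, l = l₁ ++ a :: l₂ ∧ (l₁.map f).sum < N ∧ N ≤ (l₁.map f).sum + f a := by
  induction l using List.reverseRecOn with
  | nil => simp at h; omega
  | append_singleton l a ih =>
    by_cases h' : N ≤ (l.map f).sum
    · obtain ⟨l₁, b, l₂, rfl, h₁, h₂⟩ := ih h'
      exact ⟨l₁, b, l₂ ++ [a], by simp, h₁, h₂⟩
    · exact ⟨l, a, [], rfl, by omega, by simpa using h⟩

theorem Multiset.exists_chunks {α : Type*} [DecidableEq α] (p n : ℕ) :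
    ∀ W : Multiset α, n * p ≤ W.card → ∃ Ls : List (List α), Ls.length = n ∧
      (∀ l ∈ Ls, l.length = p) ∧ (Ls.flatten : Multiset α) ≤ W := by
  induction n with
  | zero => exact fun W _ => ⟨[], rfl, by simp, by simp⟩
  | succ n ih =>
    intro W hW
    rw [add_mul, one_mul] at hW
    obtain ⟨T, hT, hTc⟩ := Multiset.exists_le_card_eq_of_le (n := p) (S := W) (by omega)
    obtain ⟨Ls, h₁, h₂, h₃⟩ := ih (W - T) (by rw [Multiset.card_sub hT]; omega)
    refine ⟨T.toList :: Ls, by simp [h₁], ?_, ?_⟩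
    · rintro l (_ | ⟨_, hl⟩)
      · simpa using hTc
      · exact h₂ l hl
    · rw [List.flatten_cons, ← Multiset.coe_add, Multiset.coe_toList]
      calc T + Ls.flatten ≤ T + (W - T) := by gcongr
        _ = W := add_tsub_cancel_of_le hT

namespace AffineCoords

variable {G : Type*} [Group G] {p q : ℕ} {D : AffineCoords G p q}

/-- Inserting blocks into a longest block `T` makes each insertion worth `T.length - 1` more than
the length it consumes. Stopping once the gains reach `q - 1` keeps the total length within `q`. -/
theorem exists_short_of_many_blocks [Fact p.Prime] [Fact q.Prime] {m : ℕ}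
    (hm : p + 1 = 2 * m) (hpq : 2 * p + 1 ≤ q) {Bs : List (List G)}
    (hBs : ∀ T ∈ Bs, D.IsBlock T ∧ T.length ≤ m) (hX : q + m ≤ Bs.flatten.length + 1) :
    ∃ l : List G, l ≠ [] ∧ l.prod = 1 ∧ l.length ≤ q ∧ (l : Multiset G) ≤ (Bs.flatten : List G) := by
  classical
  have hne : Bs.toFinset.Nonempty := by
    rw [List.toFinset_nonempty_iff]
    rintro rfl
    simp at hX
    omega
  obtain ⟨T, hT, hmax⟩ := Finset.exists_max_image Bs.toFinset List.length hne
  rw [List.mem_toFinset] at hT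
  have hperm := List.perm_cons_erase hT
  set Ts := Bs.erase T
  have hmem : ∀ U ∈ Ts, U ∈ Bs := fun U hU => List.mem_of_mem_erase hU
  have hTpos := (hBs T hT).1.length_pos
  have hTm := (hBs T hT).2
  have hmax' : ∀ U ∈ Ts, U.length ≤ T.length := fun U hU =>
    hmax U (List.mem_toFinset.2 (hmem U hU))
  -- Two lengths at most `m` have `T.length + U.length - 1 ≤ 2 * m - 1 = p`, so the minimum is never
  -- `p` by truncation.
  have hsum : ∀ As : List (List G), (∀ U ∈ As, U ∈ Ts) →
      (As.map fun U => min p (T.length + U.length - 1)).sum =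
        As.flatten.length + As.length * (T.length - 1) ∧ As.flatten.length ≤ As.length * m := by
    intro As
    induction As with
    | nil => simp
    | cons A As ih =>
      intro hA
      obtain ⟨i₁, i₂⟩ := ih fun U hU => hA U (by simp [hU])
      have hA' := hA A (by simp)
      have hAm := (hBs A (hmem A hA')).2
      rw [List.map_cons, List.sum_cons, List.flatten_cons, List.length_append, List.length_cons,
        i₁, min_eq_right (by omega), add_mul, add_mul]
      omega
  have hlen : Bs.flatten.length = T.length + Ts.flatten.length := by
    rw [hperm.flatten.length_eq, List.flatten_cons, List.length_append]
  obtain ⟨As, U, Cs, hdecomp, hlt, hge⟩ := List.exists_split_sum_ge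
    (fun U : List G => min p (T.length + U.length - 1)) (N := q - 1) (by omega) Ts (by
      rw [(hsum Ts fun U hU => hU).1]
      omega)
  have hU : U ∈ Ts := by simp [hdecomp]
  have hAs : ∀ A ∈ As, A ∈ Ts := fun A hA => by simp [hdecomp, hA]
  obtain ⟨l, h₁, h₂, h₃⟩ := exists_prod_eq_one_of_insertions (D := D) (T := T) (Ts := As ++ [U])
    (by
      intro A hA
      simp only [List.mem_cons, List.mem_append, List.not_mem_nil, or_false] at hA
      rcases hA with rfl | hA | rfl
      · exact (hBs _ hT).1
      · exact (hBs _ (hmem _ (hAs _ hA))).1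
      · exact (hBs _ (hmem _ hU)).1) (by
      simp only [List.map_append, List.sum_append, List.map_cons, List.map_nil, List.sum_cons,
        List.sum_nil]
      omega)
  refine ⟨l, h₁, h₂, ?_, ?_⟩
  · have hl := Multiset.card_le_card h₃
    simp only [Multiset.coe_card, List.flatten_cons, List.flatten_append, List.flatten_nil,
      List.length_append, List.append_nil] at hl
    obtain ⟨i₁, i₂⟩ := hsum As hAs
    rw [i₁] at hlt
    have hUT := hmax' U hU
    -- Two blocks in `As` already save `2 * (T.length - 1)`, which pays for `T` and `U`. With fewer,
    -- at most three blocks occur, of total length at most `3 * m ≤ q`.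
    by_cases hA2 : 2 ≤ As.length
    · have : 2 * (T.length - 1) ≤ As.length * (T.length - 1) := Nat.mul_le_mul_right _ hA2
      omega
    · have : As.length * m ≤ 1 * m := Nat.mul_le_mul_right _ (by omega)
      omega
  · refine h₃.trans ?_
    have hsub : (T :: (As ++ [U])).Sublist (T :: Ts) := by
      rw [hdecomp]
      refine List.Sublist.cons_cons _ (List.Sublist.append_left ?_ _)
      exact List.Sublist.cons_cons _ (List.nil_sublist _)
    refine (Multiset.coe_le.2 hsub.flatten.subperm).trans (le_of_eq ?_)
    exact (Multiset.coe_eq_coe.2 hperm.flatten).symm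

/-- A sequence of length `2 * q + p - 1` has a product-one subsequence of length at most `q`. -/
theorem exists_short_prod_eq_one_of_odd [Fact p.Prime] [Fact q.Prime] (D : AffineCoords G p q)
    {m t : ℕ} (hm : p + 1 = 2 * m) (hq : q = t * p + 1) (ht : 2 ≤ t) {S : Multiset G}
    (hS : 2 * q + p ≤ S.card + 1) :
    ∃ l : List G, l ≠ [] ∧ l.prod = 1 ∧ l.length ≤ q ∧ (l : Multiset G) ≤ S := by
  classical
  have hp := (Fact.out : p.Prime).two_le
  have hpq : 2 * p + 1 ≤ q := by
    have : 2 * p ≤ t * p := Nat.mul_le_mul_right _ ht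
    omega
  obtain ⟨Bs, hBs, hle, hmaxl⟩ := exists_maximal_blocks D m S
  by_cases hX : q + m ≤ Bs.flatten.length + 1
  · obtain ⟨l, h₁, h₂, h₃, h₄⟩ := exists_short_of_many_blocks hm hpq hBs hX
    exact ⟨l, h₁, h₂, h₃, h₄.trans hle⟩
  set R := S - (Bs.flatten : Multiset G) with hRdef
  have hRS : (Bs.flatten : Multiset G) + R = S := add_tsub_cancel_of_le hle
  have hRc : Bs.flatten.length + R.card = S.card := by rw [← hRS]; simp
  -- The rest `R` is large but has no degree-zero list of length at most `m`, so all but at most `m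
  -- - 2` of its terms share one degree `j`.
  have hj : ∃ j, R.card + 1 < (R.map D.deg).count j + m := by
    by_contra hcon
    push Not at hcon
    obtain ⟨l, h₁, h₂, h₃, h₄⟩ := exists_short_deg_zero (D := D) hm (R := R) (by omega) hcon
    have := hmaxl l h₁ h₂ h₃
    omega
  obtain ⟨j, hj⟩ := hj
  rw [Multiset.count_map] at hj
  set W := R.filter fun x => j = D.deg x with hW
  have hWR : W ≤ R := Multiset.filter_le _ _
  have hWj : ∀ x ∈ W, D.deg x = j := fun x hx => (Multiset.mem_filter.1 hx).2.symm
  have hj0 : j ≠ 0 := by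
    rintro rfl
    obtain ⟨x, hx⟩ := Multiset.card_pos_iff_exists_mem.1 (show 0 < W.card by omega)
    have := hmaxl [x] (by simp) (by
      simpa using Multiset.mem_of_le hWR hx) (by simpa using hWj x hx)
    simp at this
    omega
  by_cases hB : Bs.flatten.length ≤ m
  · obtain ⟨l, h₁, h₂, h₃, h₄⟩ := exists_prod_eq_one_of_deg_eq hj0 hWj (by omega)
    exact ⟨l, h₁, h₂, by omega, h₄.trans (hWR.trans (Multiset.sub_le_self _ _))⟩
  obtain ⟨A, B, Bs', rfl⟩ : ∃ A B Bs', Bs = A :: B :: Bs' := by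
    rcases Bs with _ | ⟨A, _ | ⟨B, Bs'⟩⟩
    · simp at hB
    · have := (hBs A (by simp)).2
      simp at hB
      omega
    · exact ⟨A, B, Bs', rfl⟩
  obtain ⟨hA, hAm⟩ := hBs A (by simp)
  obtain ⟨hB', hBm⟩ := hBs B (by simp)
  obtain ⟨s, rfl⟩ : ∃ s, t = s + 2 := ⟨t - 2, by omega⟩
  have hsp : (s + 2) * p = s * p + 2 * p := by ring
  -- Any `p` terms of degree `j` form a block of full length `p`, and every block inserted into it
  -- gains `p`. One such base, `s` more, and two short blocks `A`, `B` gain `(s + 2) * p = q - 1`.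
  -- The length is at most `(s + 1) * p + 2 * m = q`; using `A` and `B` in place of two full blocks
  -- is what achieves this.
  obtain ⟨Ls, hLs, hLp, hLW⟩ := Multiset.exists_chunks p (s + 1) W (by
    rw [add_mul]
    omega)
  obtain ⟨T, Ts, rfl⟩ : ∃ T Ts, Ls = T :: Ts := by
    cases Ls with
    | nil => simp at hLs
    | cons T Ts => exact ⟨T, Ts, rfl⟩
  have hblock : ∀ U ∈ T :: Ts, D.IsBlock U := fun U hU =>
    isBlock_of_forall hj0 (hLp U hU) fun x hx => hWj x (Multiset.mem_of_le hLW (Multiset.mem_coe.2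
      (List.mem_flatten.2 ⟨U, hU, hx⟩)))
  have hTp := hLp T (by simp)
  have hfull : ∀ U : List G, D.IsBlock U → min p (T.length + U.length - 1) = p := fun U hU => by
    have := hU.length_pos
    omega
  have hsumTs : (Ts.map fun U => min p (T.length + U.length - 1)).sum = s * p := by
    rw [List.map_eq_replicate_iff.2 (fun U hU => hfull U (hblock U (by simp [hU]))),
      List.sum_replicate]
    simp at hLs
    simp [hLs]
  obtain ⟨l, h₁, h₂, h₃⟩ := exists_prod_eq_one_of_insertions (D := D) (T := T) (Ts := A :: B :: Ts)
    (by
      intro U hU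
      simp only [List.mem_cons] at hU
      rcases hU with rfl | rfl | rfl | hU
      · exact hblock _ (by simp)
      · exact hA
      · exact hB'
      · exact hblock _ (by simp [hU])) (by
      rw [List.map_cons, List.map_cons, List.sum_cons, List.sum_cons, hsumTs, hfull A hA,
        hfull B hB']
      omega)
  have hlenTs : Ts.flatten.length = s * p := by
    rw [List.length_flatten, List.map_eq_replicate_iff.2 (fun U hU => hLp U (by simp [hU])),
      List.sum_replicate]
    simp at hLs
    simp [hLs]
  refine ⟨l, h₁, h₂, ?_, h₃.trans ?_⟩
  · have hl := Multiset.card_le_card h₃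
    simp only [Multiset.coe_card, List.flatten_cons, List.length_append] at hl
    omega
  · have e₁ : (((T :: A :: B :: Ts).flatten : List G) : Multiset G) =
        (A + B : Multiset G) + ((T :: Ts).flatten : List G) := by
      simp only [List.flatten_cons, ← Multiset.coe_add]
      abel
    rw [e₁, ← hRS]
    refine add_le_add ?_ (hLW.trans hWR)
    simp only [List.flatten_cons, ← Multiset.coe_add]
    rw [← add_assoc]
    exact Multiset.le_add_right _ _

/-- Either `q` terms have degree zero, or at least `q + 2` have degree one and two of them multiply
to one. -/
theorem exists_short_prod_eq_one_of_two [Fact q.Prime] (D : AffineCoords G 2 q) (hq : 2 ≤ q)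
    {S : Multiset G} (hS : 2 * q + 2 ≤ S.card + 1) :
    ∃ l : List G, l ≠ [] ∧ l.prod = 1 ∧ l.length ≤ q ∧ (l : Multiset G) ≤ S := by
  classical
  have hone : ∀ a : ZMod 2, ¬ a = 0 → a = 1 := by decide
  have : Fact (Nat.Prime 2) := ⟨Nat.prime_two⟩
  have hcard := congrArg Multiset.card (Multiset.filter_add_not (fun x => D.deg x = 0) S)
  rw [Multiset.card_add] at hcard
  by_cases h : q ≤ (S.filter fun x => D.deg x = 0).card
  · obtain ⟨l, h₁, h₂, h₃, h₄⟩ := exists_prod_eq_one_of_deg_eq_zero (D := D)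
      (fun x hx => (Multiset.mem_filter.1 hx).2) h
    exact ⟨l, h₁, h₂, h₃, h₄.trans (Multiset.filter_le _ _)⟩
  · obtain ⟨l, h₁, h₂, h₃, h₄⟩ := exists_prod_eq_one_of_deg_eq (D := D) (j := 1) one_ne_zero
      (W := S.filter fun x => ¬ D.deg x = 0) (fun x hx =>
        hone _ (Multiset.mem_filter.1 hx).2) (by omega)
    exact ⟨l, h₁, h₂, by omega, h₄.trans (Multiset.filter_le _ _)⟩

theorem disjointBound [Fact p.Prime] [Fact q.Prime] (D : AffineCoords G p q) (hpq : p ∣ q - 1) :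
    DisjointBound G q (p - 1) := by
  have hp := (Fact.out : p.Prime)
  have hq := (Fact.out : q.Prime)
  have hp2 := hp.two_le
  have hq2 := hq.two_le
  refine disjointBound_of_short (fun S hS => D.exists_prod_eq_one (by omega)) fun S hS => ?_
  rcases hp.eq_two_or_odd' with rfl | hodd
  · exact D.exists_short_prod_eq_one_of_two hq2 (by omega)
  · obtain ⟨a, ha⟩ := hodd
    obtain ⟨t, ht⟩ := hpq
    refine D.exists_short_prod_eq_one_of_odd (m := a + 1) (t := t) (by omega)
      (by rw [mul_comm]; omega) ?_ (by omega)
    -- For odd `p`, `t = 1` would make `q = p + 1` even and larger than `2`.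
    by_contra hlt
    interval_cases t
    · omega
    · rcases hq.eq_two_or_odd' with rfl | ⟨b, hb⟩ <;> omega

end AffineCoords

/-! ### The extremal sequence and the resulting formula. -/

theorem not_forall_hasDisjointProductOne {G : Type*} [Group G] {p n k m : ℕ} (hp : 2 ≤ p)
    (π : G →* Multiplicative (ZMod p)) {x y : G} (hx : π x = 1)
    (hy : π y = Multiplicative.ofAdd 1) (hn : 0 < n) (hxn : orderOf x = n) (hk : 0 < k)
    (hm : m < n * k + (p - 1)) : ¬ ∀ S : Fin m → G, HasDisjointProductOne k S := by
  classical
  intro h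
  obtain ⟨I, hI, hdisj⟩ := h fun i => if (i : ℕ) < p - 1 then y else x
  have key : ∀ j, (∀ i ∈ I j, p - 1 ≤ (i : ℕ)) ∧ n ≤ (I j).card := by
    intro j
    obtain ⟨hne, l, hl, hlI, hprod⟩ := hI j
    have h₁ := congrArg π hprod
    rw [map_list_prod, map_one, List.map_map, ← List.prod_toFinset _ hl, hlI] at h₁
    -- Under `π` the product counts the copies of `y` modulo `p`. There are at most `p - 1` of them,
    -- so none is used.
    have h₂ : (((I j).filter fun i : Fin m => (i : ℕ) < p - 1).card : ZMod p) = 0 := by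
      have h₃ := congrArg Multiplicative.toAdd h₁
      rw [toAdd_prod, toAdd_one] at h₃
      refine (Finset.sum_boole _ _).symm.trans (Eq.trans ?_ h₃)
      refine Finset.sum_congr rfl fun i _ => ?_
      simp only [Function.comp_apply]
      split_ifs
      · rw [hy, toAdd_ofAdd]
      · rw [hx, toAdd_one]
    have h₄ : ((I j).filter fun i : Fin m => (i : ℕ) < p - 1).card ≤ p - 1 := by
      rw [← Finset.card_range (p - 1)]
      refine Finset.card_le_card_of_injOn Fin.val (fun i hi => ?_) Fin.val_injective.injOn
      simpa using (Finset.mem_filter.1 hi).2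
    rw [ZMod.natCast_eq_zero_iff] at h₂
    have h₅ := Nat.eq_zero_of_dvd_of_lt h₂ (by omega)
    rw [Finset.card_eq_zero, Finset.filter_eq_empty_iff] at h₅
    have h₆ : ∀ i ∈ I j, p - 1 ≤ (i : ℕ) := fun i hi => not_lt.1 (h₅ hi)
    refine ⟨h₆, ?_⟩
    have h₇ : l.map (fun i : Fin m => if (i : ℕ) < p - 1 then y else x) =
        List.replicate l.length x := by
      refine List.map_eq_replicate_iff.2 fun i hi => ?_
      rw [if_neg (not_lt.2 (h₆ i (by rw [← hlI]; simpa using hi)))]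
    rw [h₇, List.prod_replicate] at hprod
    have h₈ := orderOf_dvd_of_pow_eq_one hprod
    rw [hxn, ← List.toFinset_card_of_nodup hl, hlI] at h₈
    exact Nat.le_of_dvd hne.card_pos h₈
  have h₁ : n * k ≤ (Finset.univ.biUnion I).card := by
    rw [Finset.card_biUnion fun i _ j _ hij => hdisj i j hij]
    calc n * k = ∑ _j : Fin k, n := by simp [mul_comm]
      _ ≤ _ := Finset.sum_le_sum fun j _ => (key j).2
  have h₂ : (Finset.univ.biUnion I).card ≤ m - (p - 1) := by
    rw [← Nat.card_Ico]
    refine Finset.card_le_card_of_injOn Fin.val (fun i hi => ?_) Fin.val_injective.injOn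
    obtain ⟨j, -, hj⟩ := Finset.mem_biUnion.1 hi
    simpa using (key j).1 i hj
  have := Nat.mul_pos hn hk
  omega

theorem kthDavenport_eq {G : Type*} [Group G] {p n k : ℕ} (hp : 2 ≤ p)
    (π : G →* Multiplicative (ZMod p)) {x y : G} (hx : π x = 1)
    (hy : π y = Multiplicative.ofAdd 1) (hn : 0 < n) (hxn : orderOf x = n)
    (hG : DisjointBound G n (p - 1)) (hk : 0 < k) : kthDavenport k G = n * k + (p - 1) := by
  apply IsLeast.csInf_eq
  refine ⟨⟨by omega, fun S => (hG k _ hk (by simp)).hasDisjointProductOne⟩, ?_⟩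
  rintro m ⟨-, hm⟩
  by_contra hlt
  exact not_forall_hasDisjointProductOne hp π hx hy hn hxn hk (not_le.1 hlt) hm

/-! ### Metacyclic groups and their small quotients. -/

section Metacyclic

/-- The coordinates of the group `ℤ/p ⋉ ℤ/q` with `q` prime. -/
def MetacyclicGroup.affineCoords {p q : ℕ} [Fact p.Prime] (g : (ZMod q)ˣ) (hg : orderOf g = p) :
    AffineCoords (MetacyclicGroup p q g hg) p q where
  deg x := x.right.toAdd
  deg_mul _ _ := rfl
  wt d := (g ^ d.val : (ZMod q)ˣ)
  wt_zero := by simp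
  wt_add a b := by
    have h : g ^ p = 1 := by
      rw [← hg]
      exact pow_orderOf_eq_one g
    rw [ZMod.val_add, ← pow_eq_pow_mod _ h, pow_add, Units.val_mul]
  wt_injective a b hab := by
    have h := pow_injOn_Iio_orderOf (x := g) (by simpa [hg] using a.val_lt)
      (by simpa [hg] using b.val_lt) (Units.ext hab)
    exact ZMod.val_injective p h
  coc x := x.left.toAdd
  coc_mul _ _ := rfl
  ext _ _ h₁ h₂ := SemidirectProduct.ext h₂ h₁

theorem MetacyclicGroup.natCard {p n : ℕ} (g : (ZMod n)ˣ) (hg : orderOf g = p) :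
    Nat.card (MetacyclicGroup p n g hg) = n * p := by
  rw [SemidirectProduct.card]
  exact congrArg₂ (· * ·) (Nat.card_zmod n) (Nat.card_zmod p)

theorem MetacyclicGroup.disjointBound_of_prime {p q : ℕ} [Fact p.Prime] [Fact q.Prime]
    (g : (ZMod q)ˣ) (hg : orderOf g = p) : DisjointBound (MetacyclicGroup p q g hg) q (p - 1) := by
  refine (MetacyclicGroup.affineCoords g hg).disjointBound ?_
  rw [← hg, ← ZMod.card_units q]
  exact orderOf_dvd_card

/-- Reduction of the normal factor of `ℤ/p ⋉ ℤ/n` modulo a divisor of `n`. -/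
def MetacyclicGroup.castHom {p n q : ℕ} (hqn : q ∣ n) (g : (ZMod n)ˣ) (hg : orderOf g = p)
    (g' : (ZMod q)ˣ) (hg' : orderOf g' = p) (h : ZMod.unitsMap hqn g = g') :
    MetacyclicGroup p n g hg →* MetacyclicGroup p q g' hg' :=
  SemidirectProduct.map (AddMonoidHom.toMultiplicative (ZMod.castHom hqn (ZMod q)).toAddMonoidHom)
    (MonoidHom.id _) (by
      intro d
      refine MonoidHom.ext fun x => ?_
      apply Multiplicative.toAdd.injective
      change ZMod.castHom hqn (ZMod q) (((g ^ d.toAdd.val : (ZMod n)ˣ) : ZMod n) * x.toAdd) =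
        ((g' ^ d.toAdd.val : (ZMod q)ˣ) : ZMod q) * ZMod.castHom hqn (ZMod q) x.toAdd
      rw [map_mul, ← h, ← map_pow]
      rfl)

theorem MetacyclicGroup.castHom_surjective {p n q : ℕ} (hqn : q ∣ n) (g : (ZMod n)ˣ)
    (hg : orderOf g = p) (g' : (ZMod q)ˣ) (hg' : orderOf g' = p) (h : ZMod.unitsMap hqn g = g') :
    Function.Surjective (MetacyclicGroup.castHom hqn g hg g' hg' h) := by
  intro x
  obtain ⟨a, ha⟩ := ZMod.castHom_surjective hqn x.left.toAdd
  exact ⟨⟨Multiplicative.ofAdd a, x.right⟩, SemidirectProduct.ext ha rfl⟩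

/-- If `g ≡ 1` modulo `p`, then `ℤ/p ⋉ ℤ/n` maps to `ℤ/p × ℤ/p`. -/
def MetacyclicGroup.abelianHom {p n : ℕ} (hpn : p ∣ n) (g : (ZMod n)ˣ) (hg : orderOf g = p)
    (h : ZMod.unitsMap hpn g = 1) :
    MetacyclicGroup p n g hg →* Multiplicative (ZMod p) × Multiplicative (ZMod p) :=
  MonoidHom.prod
    (SemidirectProduct.lift
      (AddMonoidHom.toMultiplicative (ZMod.castHom hpn (ZMod p)).toAddMonoidHom) 1 (by
        intro d
        refine MonoidHom.ext fun x => ?_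
        apply Multiplicative.toAdd.injective
        have h1 : ZMod.castHom hpn (ZMod p) ((g ^ d.toAdd.val : (ZMod n)ˣ) : ZMod n) = 1 := by
          have := congrArg Units.val (congrArg (· ^ d.toAdd.val) h)
          simp only [← map_pow, one_pow] at this
          exact this
        have h2 : ZMod.castHom hpn (ZMod p) (((g ^ d.toAdd.val : (ZMod n)ˣ) : ZMod n) * x.toAdd) =
            ZMod.castHom hpn (ZMod p) x.toAdd := by rw [map_mul, h1, one_mul]
        simp only [MonoidHom.comp_apply, MonoidHom.one_apply, map_one]
        exact h2))
    SemidirectProduct.rightHom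

theorem MetacyclicGroup.abelianHom_surjective {p n : ℕ} (hpn : p ∣ n) (g : (ZMod n)ˣ)
    (hg : orderOf g = p) (h : ZMod.unitsMap hpn g = 1) :
    Function.Surjective (MetacyclicGroup.abelianHom hpn g hg h) := by
  intro x
  obtain ⟨a, ha⟩ := ZMod.castHom_surjective hpn x.1.toAdd
  refine ⟨⟨Multiplicative.ofAdd a, x.2⟩, Prod.ext ?_ rfl⟩
  change (Multiplicative.ofAdd (ZMod.castHom hpn (ZMod p) a)) * 1 = x.1
  rw [ha, mul_one]
  rfl

/-- A unit of prime order `p` modulo `n`, with `p` not dividing `n`, has order `p` modulo some prime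
divisor of `n`. -/
theorem ZMod.exists_prime_orderOf_unitsMap {p n : ℕ} (hp : p.Prime) (hn : 0 < n) (hpn : ¬ p ∣ n)
    (g : (ZMod n)ˣ) (hg : orderOf g = p) :
    ∃ (q : ℕ) (_ : q.Prime) (hqn : q ∣ n), orderOf (ZMod.unitsMap hqn g) = p := by
  have : NeZero n := ⟨hn.ne'⟩
  by_contra hcon
  push Not at hcon
  have h1 : ∀ (q : ℕ) (hq : q.Prime) (hqn : q ∣ n), ZMod.unitsMap hqn g = 1 := by
    intro q hq hqn
    have hd : orderOf (ZMod.unitsMap hqn g) ∣ p := (orderOf_map_dvd _ g).trans hg.dvd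
    rcases (Nat.dvd_prime hp).1 hd with h | h
    · exact orderOf_eq_one_iff.1 h
    · exact absurd h (hcon q hq hqn)
  -- If `g ≡ 1` modulo every prime `q ∣ n`, then `s ≡ p` modulo each of them, so `s` is a unit as `p
  -- ∤ n`. Then `s * (g - 1) = g ^ p - 1 = 0` forces `g = 1`.
  let s : ZMod n := ∑ i ∈ Finset.range p, (g : ZMod n) ^ i
  have hs : IsUnit s := by
    rw [← ZMod.natCast_zmod_val s, ZMod.isUnit_iff_coprime]
    refine Nat.Coprime.symm (Nat.coprime_of_dvd fun q hq hqn hqs => hpn ?_)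
    have h2 : ZMod.castHom hqn (ZMod q) s = 0 := by
      rw [← ZMod.natCast_zmod_val s, map_natCast, ZMod.natCast_eq_zero_iff]
      exact hqs
    have h3 : ZMod.castHom hqn (ZMod q) (g : ZMod n) = 1 := congrArg Units.val (h1 q hq hqn)
    rw [map_sum] at h2
    simp only [map_pow, h3, one_pow, Finset.sum_const, Finset.card_range, nsmul_eq_mul,
      mul_one] at h2
    rw [ZMod.natCast_eq_zero_iff] at h2
    rwa [← (Nat.prime_dvd_prime_iff_eq hq hp).1 h2]
  have h4 : s * ((g : ZMod n) - 1) = 0 := by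
    rw [geom_sum_mul, ← Units.val_pow_eq_pow_val, ← hg, pow_orderOf_eq_one, Units.val_one, sub_self]
  have h5 : (g : ZMod n) = 1 := sub_eq_zero.1 (hs.mul_right_eq_zero.1 h4)
  have h6 : g = 1 := Units.ext h5
  rw [h6, orderOf_one] at hg
  exact hp.one_lt.ne hg

/-- The order of the image divides both `p` and `p - 1`, the order of `(ℤ/p)ˣ`. -/
theorem ZMod.unitsMap_eq_one_of_orderOf {p n : ℕ} (hp : p.Prime) (hpn : p ∣ n)
    (g : (ZMod n)ˣ) (hg : orderOf g = p) : ZMod.unitsMap hpn g = 1 := by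
  have : Fact p.Prime := ⟨hp⟩
  have h1 : orderOf (ZMod.unitsMap hpn g) ∣ p := (orderOf_map_dvd _ g).trans hg.dvd
  have h2 : orderOf (ZMod.unitsMap hpn g) ∣ p - 1 := by
    rw [← ZMod.card_units p]
    exact orderOf_dvd_card
  have h3 : p - 1 < p := Nat.sub_lt hp.pos one_pos
  rcases (Nat.dvd_prime hp).1 h1 with h | h
  · exact orderOf_eq_one_iff.1 h
  · rw [h] at h2
    have := Nat.le_of_dvd (by have := hp.two_le; omega) h2
    omega

theorem MetacyclicGroup.disjointBound {p n : ℕ} (hp : p.Prime) (hn : 0 < n) (g : (ZMod n)ˣ)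
    (hg : orderOf g = p) : DisjointBound (MetacyclicGroup p n g hg) n (p - 1) := by
  have : Fact p.Prime := ⟨hp⟩
  have : Finite (MetacyclicGroup p n g hg) := Nat.finite_of_card_ne_zero (by
    rw [MetacyclicGroup.natCard]
    exact (Nat.mul_pos hn hp.pos).ne')
  by_cases hpn : p ∣ n
  · have h := ZMod.unitsMap_eq_one_of_orderOf hp hpn g hg
    obtain ⟨t, rfl⟩ := id hpn
    refine DisjointBound.of_surjective _ (MetacyclicGroup.abelianHom_surjective hpn g hg h)
      (Nat.pos_of_mul_pos_left hn) ?_ (disjointBound_prod_zmod p)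
    rw [MetacyclicGroup.natCard]
    simp
    ring
  · obtain ⟨q, hq, hqn, h⟩ := ZMod.exists_prime_orderOf_unitsMap hp hn hpn g hg
    have : Fact q.Prime := ⟨hq⟩
    obtain ⟨t, rfl⟩ := id hqn
    refine DisjointBound.of_surjective _ (MetacyclicGroup.castHom_surjective hqn g hg _ h rfl)
      (Nat.pos_of_mul_pos_left hn) ?_ (MetacyclicGroup.disjointBound_of_prime _ h)
    rw [MetacyclicGroup.natCard, MetacyclicGroup.natCard]
    ring

end Metacyclic

/-! ### Dihedral groups. -/

section Dihedral

/-- Reduction of the dihedral group of order `2 * n` modulo a divisor `q` of `n`. -/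
def DihedralGroup.metacyclicHom {n q : ℕ} (hqn : q ∣ n) (hg : orderOf (-1 : (ZMod q)ˣ) = 2) :
    DihedralGroup n →* MetacyclicGroup 2 q (-1) hg :=
  MonoidHom.mk' (fun x => match x with
    | .r i => ⟨Multiplicative.ofAdd (ZMod.castHom hqn (ZMod q) i), 1⟩
    -- Here `sr i` is `s * r ^ i = r ^ (-i) * s`, and the semidirect product puts the normal factor
    -- first; hence the sign.
    | .sr i => ⟨Multiplicative.ofAdd (-ZMod.castHom hqn (ZMod q) i), Multiplicative.ofAdd 1⟩) (by
    have h0 : ∀ i : ZMod q, metacyclicAction 2 q (-1) hg 1 (Multiplicative.ofAdd i) =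
        Multiplicative.ofAdd i := fun i => by rw [map_one]; rfl
    have h1 : ∀ i : ZMod q, metacyclicAction 2 q (-1) hg (Multiplicative.ofAdd 1)
        (Multiplicative.ofAdd i) = Multiplicative.ofAdd (-i) := fun i => by
      change Multiplicative.ofAdd ((((-1 : (ZMod q)ˣ) ^ 1 : (ZMod q)ˣ) : ZMod q) * i) = _
      simp
    have h2 : (Multiplicative.ofAdd 1 * Multiplicative.ofAdd 1 : Multiplicative (ZMod 2)) = 1 := by
      decide
    rintro (i | i) (j | j)
    all_goals
      apply SemidirectProduct.ext
      · simp only [DihedralGroup.r_mul_r, DihedralGroup.r_mul_sr, DihedralGroup.sr_mul_r,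
          DihedralGroup.sr_mul_sr, SemidirectProduct.mul_left, h0, h1, ← ofAdd_add, map_add, map_sub] <;>
        exact congrArg Multiplicative.ofAdd (by ring)
      · simp [h2])

/-- The dihedral group of order `2 * n` with `n` even maps to `ℤ/2 × ℤ/2`. -/
def DihedralGroup.abelianHom {n : ℕ} (hn : 2 ∣ n) :
    DihedralGroup n →* Multiplicative (ZMod 2) × Multiplicative (ZMod 2) :=
  MonoidHom.mk' (fun x => match x with
    | .r i => (Multiplicative.ofAdd (ZMod.castHom hn (ZMod 2) i), 1)
    | .sr i => (Multiplicative.ofAdd (ZMod.castHom hn (ZMod 2) i), Multiplicative.ofAdd 1)) (by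
    have h2 : (Multiplicative.ofAdd 1 * Multiplicative.ofAdd 1 : Multiplicative (ZMod 2)) = 1 := by
      decide
    have h3 : ∀ a b : ZMod 2, a - b = b + a := by decide
    rintro (i | i) (j | j)
    all_goals
      apply Prod.ext
      · change Multiplicative.ofAdd (ZMod.castHom hn (ZMod 2) _) =
          Multiplicative.ofAdd (ZMod.castHom hn (ZMod 2) i + ZMod.castHom hn (ZMod 2) j)
        simp only [map_add, map_sub, h3]
      · simp [h2])

theorem DihedralGroup.disjointBound {n : ℕ} (hn : 2 ≤ n) : DisjointBound (DihedralGroup n) n 1 := by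
  have : NeZero n := ⟨by omega⟩
  have htwo : ∀ b : Multiplicative (ZMod 2), b = 1 ∨ b = Multiplicative.ofAdd 1 := by decide
  have hcard : Nat.card (DihedralGroup n) = 2 * n := DihedralGroup.nat_card
  obtain ⟨q, hq, hqn⟩ := Nat.exists_prime_and_dvd (show n ≠ 1 by omega)
  have : Fact q.Prime := ⟨hq⟩
  have : Fact (Nat.Prime 2) := ⟨Nat.prime_two⟩
  rcases hq.eq_two_or_odd' with rfl | hodd
  · have hsurj : Function.Surjective (DihedralGroup.abelianHom hqn) := by
      rintro ⟨a, b⟩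
      obtain ⟨i, hi⟩ := ZMod.castHom_surjective hqn a.toAdd
      rcases htwo b with rfl | rfl
      · exact ⟨.r i, Prod.ext hi rfl⟩
      · exact ⟨.sr i, Prod.ext hi rfl⟩
    obtain ⟨t, rfl⟩ := id hqn
    refine DisjointBound.of_surjective _ hsurj (by omega) ?_ (disjointBound_prod_zmod 2)
    rw [hcard]
    simp
    ring
  · have hg : orderOf (-1 : (ZMod q)ˣ) = 2 := by
      rw [← orderOf_units, Units.val_neg, Units.val_one, orderOf_neg_one, ZMod.ringChar_zmod_n,
        if_neg]
      rintro rfl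
      exact absurd hodd (by decide)
    have hsurj : Function.Surjective (DihedralGroup.metacyclicHom hqn hg) := by
      rintro ⟨a, b⟩
      obtain ⟨i, hi⟩ := ZMod.castHom_surjective hqn a.toAdd
      rcases htwo b with rfl | rfl
      · exact ⟨.r i, SemidirectProduct.ext hi rfl⟩
      · refine ⟨.sr (-i), SemidirectProduct.ext (congrArg Multiplicative.ofAdd
          (?_ : -ZMod.castHom hqn (ZMod q) (-i) = a.toAdd)) rfl⟩
        rw [map_neg, neg_neg, hi]
    obtain ⟨t, rfl⟩ := id hqn
    refine DisjointBound.of_surjective _ hsurj (Nat.pos_of_mul_pos_left (show 0 < q * t by omega)) ?_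
      (MetacyclicGroup.disjointBound_of_prime (-1) hg)
    rw [hcard, MetacyclicGroup.natCard]
    ring

/-- The sign of an element of a dihedral group. -/
def DihedralGroup.signHom (n : ℕ) : DihedralGroup n →* Multiplicative (ZMod 2) :=
  MonoidHom.mk' (fun x => match x with
    | .r _ => 1
    | .sr _ => Multiplicative.ofAdd 1) (by
    rintro (i | i) (j | j) <;> simp
    decide)

end Dihedral

/-! ### Dicyclic groups, as extensions of dihedral groups by a kernel of order two. -/

section Quaternion

/-- The quotient of a dicyclic group by its center. -/
def QuaternionGroup.dihedralHom (n : ℕ) : QuaternionGroup n →* DihedralGroup n :=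
  MonoidHom.mk' (fun x => match x with
    | .a i => .r (ZMod.castHom (dvd_mul_left n 2) (ZMod n) i)
    | .xa i => .sr (ZMod.castHom (dvd_mul_left n 2) (ZMod n) i)) (by
    rintro (i | i) (j | j)
    · simp only [QuaternionGroup.a_mul_a, DihedralGroup.r_mul_r, map_add]
    · simp only [QuaternionGroup.a_mul_xa, DihedralGroup.r_mul_sr, map_sub]
    · simp only [QuaternionGroup.xa_mul_a, DihedralGroup.sr_mul_r, map_add]
    · simp only [QuaternionGroup.xa_mul_xa, DihedralGroup.sr_mul_sr, map_add, map_sub, map_natCast,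
        ZMod.natCast_self, zero_add])

theorem QuaternionGroup.dihedralHom_surjective (n : ℕ) :
    Function.Surjective (QuaternionGroup.dihedralHom n) := by
  rintro (i | i)
  all_goals obtain ⟨j, rfl⟩ := ZMod.castHom_surjective (dvd_mul_left n 2) i
  · exact ⟨.a j, rfl⟩
  · exact ⟨.xa j, rfl⟩

theorem QuaternionGroup.disjointBound {n : ℕ} (hn : 2 ≤ n) :
    DisjointBound (QuaternionGroup n) (2 * n) 1 := by
  have : NeZero n := ⟨by omega⟩
  rw [mul_comm]
  refine DisjointBound.of_surjective _ (QuaternionGroup.dihedralHom_surjective n) two_pos ?_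
    (DihedralGroup.disjointBound hn)
  rw [DihedralGroup.nat_card, Nat.card_eq_fintype_card, QuaternionGroup.card]
  ring

end Quaternion

theorem mainTheorem7 (p k n : ℕ) (hp : p.Prime) (hk : 0 < k) (hn : 0 < n) :
    (2 ≤ n → kthDavenport k (DihedralGroup n) = n * k + 1) ∧
    (2 ≤ n → kthDavenport k (QuaternionGroup n) = 2 * n * k + 1) ∧
    (∀ (g : (ZMod n)ˣ) (hg : orderOf g = p),
      kthDavenport k (MetacyclicGroup p n g hg) = n * k + p - 1) := by
  have : NeZero n := ⟨hn.ne'⟩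
  refine ⟨fun h => ?_, fun h => ?_, fun g hg => ?_⟩
  · exact kthDavenport_eq le_rfl (DihedralGroup.signHom n) (x := .r 1) (y := .sr 0) rfl rfl hn
      DihedralGroup.orderOf_r_one (DihedralGroup.disjointBound h) hk
  · exact kthDavenport_eq le_rfl ((DihedralGroup.signHom n).comp (QuaternionGroup.dihedralHom n))
      (x := .a 1) (y := .xa 0) rfl rfl (by omega) QuaternionGroup.orderOf_a_one
      (QuaternionGroup.disjointBound h) hk
  · have hp2 := hp.two_le
    rw [kthDavenport_eq hp2 SemidirectProduct.rightHom
      (x := SemidirectProduct.inl (Multiplicative.ofAdd (1 : ZMod n)))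
      (y := SemidirectProduct.inr (Multiplicative.ofAdd (1 : ZMod p)))
      (SemidirectProduct.rightHom_inl _) (SemidirectProduct.rightHom_inr _) hn (by
        rw [orderOf_injective _ SemidirectProduct.inl_injective, orderOf_ofAdd_eq_addOrderOf,
          ZMod.addOrderOf_one])
      (MetacyclicGroup.disjointBound hp hn g hg) hk]
    omega
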